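/- Rings are commutative with $1$. A pointed monoid is a commutative monoid $A$ with an absorbing element $0$; morphisms preserve products, $0$ and $1$; for a ring $S$, $S^\bullet$ is its multiplicative monoid. $\mathrm{MSpec}\,A$ is the set of (proper) prime ideals of $A$, with the topology generated by the sets $U_h=\{I : h\notin I\}$ and its usual structure sheaf of pointed monoids, for which $\Gamma(U_h)=A[h^{-1}]$. A monoid scheme is a topological space with a sheaf of pointed monoids that is covered by open subspaces isomorphic to some $\mathrm{MSpec}\,A$; its open subspaces of this form are called affine, and an affine open $U$ is identified with $\mathrm{MSpec}\,\Gamma U$. For a ring $R$ let $A_R=R[A]/\langle 1_R0_A\rangle$. For a monoid scheme $X$ let $X_R=\mathrm{colim}_U\, U_R$, where $U$ runs over the affine opens of $X$ and $U_R=\mathrm{Spec}((\Gamma U)_R)$; this is a scheme covered by the open subschemes $U_R$. The continuous map underlying the projection $p_R:X_R^\bullet\to X$ is the one which, on each $U_R$, sends a prime ideal $\mathfrak p$ to the point of $U=\mathrm{MSpec}\,\Gamma U$ given by the preimage of $\mathfrak p$ in $\Gamma U$. A strong prime congruence on $A$ is a congruence $\mathfrak c$ on $A$ such that $A/\mathfrak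 c$ is isomorphic to a pointed submonoid of $K^\bullet$ for some field $K$. $\mathrm{SCong}\,A$ is the set of these, with the topology generated by the sets $\{\mathfrak c : (a,b)\notin\mathfrak c\}$ for $a,b\in A$. For a monoid scheme $X$ let $\mathrm{SCong}\,X=\mathrm{colim}_U\,\mathrm{SCong}\,\Gamma U$ (as topological spaces, over the affine opens $U$ of $X$), and let $\pi_X:\mathrm{SCong}\,X\to X$ be the continuous map that on $\mathrm{SCong}\,\Gamma U$ sends $\mathfrak c$ to the prime ideal $I_{\mathfrak c}=\{a : (a,0)\in\mathfrak c\}$ of $\Gamma U$. A ring $S$ and a morphism $\varphi:A\to S^\bullet$ induce the continuous map $\varphi^*:\mathrm{Spec}\,S\to\mathrm{SCong}\,A$, $\mathfrak p\mapsto\{(a,b) : \varphi(a)\equiv\varphi(b) \bmod \mathfrak p\}$. **Theorem.** Let $X$ be a monoid scheme and $R$ a ring. 1. For every affine open $U$ of $X$, the canonical map $\mathrm{SCong}\,\Gamma U\to\mathrm{SCong}\,X$ is an open embedding; write $\mathrm{SCong}\,U$ for its image. 2. There is a unique continuous map $\gamma:X_R\to\mathrm{SCong}\,X$ such that, for every affine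 open $U$ of $X$, $\gamma(U_R)\subseteq\mathrm{SCong}\,U$ and $\gamma|_{U_R}:U_R\to\mathrm{SCong}\,U=\mathrm{SCong}\,\Gamma U$ is the map induced by the canonical morphism $\Gamma U\to((\Gamma U)_R)^\bullet$. It satisfies $\pi_X\circ\gamma=p_R$ as continuous maps. 3. For $R=\mathbb Z$, the map $\gamma:X_{\mathbb Z}\to\mathrm{SCong}\,X$ is surjective. -/

import Mathlib

open CategoryTheory CategoryTheory.Limits Opposite TopologicalSpace AlgebraicGeometry

universe u v

/-- A (commutative) pointed monoid: a commutative monoid with an absorbing element. -/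
structure PMon : Type (u + 1) where
  of ::
  carrier : Type u
  [str : CommMonoidWithZero carrier]

attribute [instance] PMon.str

namespace PMon

instance : CoeSort PMon.{u} (Type u) := ⟨PMon.carrier⟩

instance : LargeCategory PMon.{u} where
  Hom A B := A →*₀ B
  id A := MonoidWithZeroHom.id A
  comp f g := g.comp f

instance : ConcreteCategory PMon.{u} (fun A B => A →*₀ B) where
  hom f := f
  ofHom f := f

/-- A morphism of pointed monoids as an arrow in the category. -/
abbrev ofHom {A B : Type u} [CommMonoidWithZero A] [CommMonoidWithZero B] (f : A →*₀ B) :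
    PMon.of A ⟶ PMon.of B := ConcreteCategory.ofHom (C := PMon.{u}) f

/-- The morphism of pointed monoids underlying an arrow. -/
abbrev hom {A B : PMon.{u}} (f : A ⟶ B) : A →*₀ B := ConcreteCategory.hom f

@[simp] lemma hom_id (A : PMon.{u}) : hom (𝟙 A) = MonoidWithZeroHom.id A := rfl

@[simp] lemma hom_comp {A B C : PMon.{u}} (f : A ⟶ B) (g : B ⟶ C) :
    hom (f ≫ g) = (hom g).comp (hom f) := rfl

@[simp] lemma hom_ofHom {A B : Type u} [CommMonoidWithZero A] [CommMonoidWithZero B]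
    (f : A →*₀ B) : hom (ofHom f) = f := rfl

lemma isIso_of_bijective {A B : PMon.{u}} (f : A ⟶ B) (hf : Function.Bijective (hom f)) :
    IsIso f := by
  let e : A ≃* B := MulEquiv.ofBijective (hom f) hf
  refine ⟨ofHom (MonoidWithZeroHom.ofClass e.symm : B →*₀ A), ?_, ?_⟩
  · apply ConcreteCategory.hom_ext
    intro x
    exact e.symm_apply_apply x
  · apply ConcreteCategory.hom_ext
    intro x
    exact e.apply_symm_apply x

lemma bijective_of_isIso {A B : PMon.{u}} (f : A ⟶ B) [IsIso f] :
    Function.Bijective (hom f) := ConcreteCategory.bijective_of_isIso f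

instance : (forget PMon.{u}).ReflectsIsomorphisms where
  reflects f _ := isIso_of_bijective f
    ((CategoryTheory.isIso_iff_bijective ((forget PMon.{u}).map f)).1 inferInstance)

instance : ReflectsLimitsOfSize.{v, v} (forget PMon.{u}) where
  reflectsLimitsOfShape {J _} := ⟨fun {K} => ⟨fun {c} hc => by
    have key : ∀ t : ∀ j, K.obj j, (∀ {i j} (f : i ⟶ j), hom (K.map f) (t i) = t j) →
        ∃! x : c.pt, ∀ j, hom (c.π.app j) x = t j := fun t ht =>
      (Types.isLimit_iff _).1 ⟨hc⟩ t ht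
    have nat : ∀ (s : Cone K) {i j} (f : i ⟶ j) (y : s.pt),
        hom (K.map f) (hom (s.π.app i) y) = hom (s.π.app j) y := fun s i j f y =>
      ConcreteCategory.congr_hom (s.w f) y
    have inj : ∀ a b : c.pt, (∀ j, hom (c.π.app j) a = hom (c.π.app j) b) → a = b :=
      fun a b h => (key (fun j => hom (c.π.app j) b) fun f => nat c f b).unique h fun _ => rfl
    have ex : ∀ (s : Cone K) (y : s.pt), ∃ x : c.pt, ∀ j, hom (c.π.app j) x = hom (s.π.app j) y :=
      fun s y => (key (fun j => hom (s.π.app j) y) fun f => nat s f y).exists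
    choose l hl using ex
    exact ⟨{
      lift := fun s => ofHom
        { toFun := l s
          map_zero' := inj _ _ fun j => by rw [hl, map_zero, map_zero]
          map_one' := inj _ _ fun j => by rw [hl, map_one, map_one]
          map_mul' := fun a b => inj _ _ fun j => by rw [hl, map_mul, map_mul, hl, hl] }
      fac := fun s j => ConcreteCategory.hom_ext _ _ fun y => hl s y j
      uniq := fun s m hm => ConcreteCategory.hom_ext _ _ fun y => inj _ _ fun j =>
        (ConcreteCategory.congr_hom (hm j) y).trans (hl s y j).symm }⟩⟩⟩

end PMon

/-- A prime ideal of a pointed monoid: a proper ideal `I` such that `A / I` has no zero divisors. -/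
@[ext]
structure PrimeIdeal (A : PMon.{u}) where
  carrier : Set A
  zero_mem : (0 : A) ∈ carrier
  mul_mem : ∀ (a : A) {x : A}, x ∈ carrier → a * x ∈ carrier
  one_notMem : (1 : A) ∉ carrier
  mem_or_mem : ∀ {a b : A}, a * b ∈ carrier → a ∈ carrier ∨ b ∈ carrier

namespace PrimeIdeal

variable {A B C : PMon.{u}}

instance : SetLike (PrimeIdeal A) A where
  coe := carrier
  coe_injective _ _ h := PrimeIdeal.ext h

lemma mul_mem_iff (p : PrimeIdeal A) {a b : A} : a * b ∈ p ↔ a ∈ p ∨ b ∈ p :=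
  ⟨p.mem_or_mem, fun h => h.elim (fun h => mul_comm a b ▸ p.mul_mem b h) (p.mul_mem a)⟩

lemma one_nmem (p : PrimeIdeal A) : (1 : A) ∉ p := p.one_notMem

lemma mul_nmem (p : PrimeIdeal A) {a b : A} (ha : a ∉ p) (hb : b ∉ p) : a * b ∉ p :=
  fun h => (p.mem_or_mem h).elim ha hb

lemma not_mem_of_isUnit (p : PrimeIdeal A) {a : A} (ha : IsUnit a) : a ∉ p := fun h => by
  obtain ⟨b, hb⟩ := ha.exists_left_inv
  exact p.one_notMem (hb ▸ p.mul_mem b h)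

/-- The multiplicative subset `A \ p`. -/
def compl (p : PrimeIdeal A) : Submonoid A where
  carrier := {a | a ∉ p}
  one_mem' := p.one_notMem
  mul_mem' ha hb h := (p.mem_or_mem h).elim ha hb

lemma mem_compl (p : PrimeIdeal A) {a : A} : a ∈ p.compl ↔ a ∉ p := Iff.rfl

/-- The pullback of a prime ideal along a morphism. -/
def comap (f : A →*₀ B) (q : PrimeIdeal B) : PrimeIdeal A where
  carrier := {a | f a ∈ q}
  zero_mem := by
    show f 0 ∈ q
    rw [map_zero]
    exact q.zero_mem
  mul_mem a x hx := by
    show f (a * x) ∈ q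
    rw [map_mul]
    exact q.mul_mem _ hx
  one_notMem h := q.one_notMem (map_one f ▸ h)
  mem_or_mem {a b} h := q.mem_or_mem (map_mul f a b ▸ h)

lemma mem_comap (f : A →*₀ B) (q : PrimeIdeal B) {a : A} : a ∈ q.comap f ↔ f a ∈ q := Iff.rfl

/-- The set `U_h` of prime ideals not containing `h`. -/
def basicSet (h : A) : Set (PrimeIdeal A) := {p | h ∉ p}

/-- The topology of the spectrum, generated by the sets `U_h`. -/
instance : TopologicalSpace (PrimeIdeal A) :=
  TopologicalSpace.generateFrom (Set.range basicSet)

/-- The principal open subset `U_h`. -/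
def basicOpen (h : A) : Opens (PrimeIdeal A) :=
  ⟨basicSet h, TopologicalSpace.isOpen_generateFrom_of_mem ⟨h, rfl⟩⟩

lemma mem_basicOpen {h : A} {p : PrimeIdeal A} : p ∈ basicOpen h ↔ h ∉ p := Iff.rfl

lemma exists_basicOpen {V : Set (PrimeIdeal A)} (hV : IsOpen V) {p : PrimeIdeal A} (hp : p ∈ V) :
    ∃ h : A, h ∉ p ∧ ∀ q : PrimeIdeal A, h ∉ q → q ∈ V := by
  induction hV with
  | basic s hs =>
    obtain ⟨h, rfl⟩ := hs
    exact ⟨h, hp, fun q hq => hq⟩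
  | univ => exact ⟨1, p.one_notMem, fun _ _ => trivial⟩
  | inter s t _ _ ihs iht =>
    obtain ⟨h, hh, h'⟩ := ihs hp.1
    obtain ⟨g, hg, g'⟩ := iht hp.2
    refine ⟨h * g, fun hm => (p.mem_or_mem hm).elim hh hg, fun q hq => ⟨h' q ?_, g' q ?_⟩⟩
    · exact fun hm => hq (q.mul_mem_iff.2 (Or.inl hm))
    · exact fun hm => hq (q.mul_mem_iff.2 (Or.inr hm))
  | sUnion S _ ih =>
    obtain ⟨s, hs, hps⟩ := hp
    obtain ⟨h, hh, h'⟩ := ih s hs hps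
    exact ⟨h, hh, fun q hq => ⟨s, hs, h' q hq⟩⟩

lemma continuous_comap (f : A →*₀ B) : Continuous (comap f) := by
  refine continuous_generateFrom_iff.2 ?_
  rintro _ ⟨h, rfl⟩
  exact (basicOpen (f h)).isOpen

/-- The largest prime ideal, consisting of the non-invertible elements. -/
def top (A : PMon.{u}) [Nontrivial A] : PrimeIdeal A where
  carrier := {a | ¬ IsUnit a}
  zero_mem := not_isUnit_zero
  mul_mem a x hx h := hx (isUnit_of_mul_isUnit_right h)
  one_notMem h := h isUnit_one
  mem_or_mem {a b} h := by
    by_contra hc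
    simp only [Set.mem_ofPred_eq, not_or, not_not] at hc
    exact h (hc.1.mul hc.2)

lemma eq_univ_of_top_mem [Nontrivial A] {V : Set (PrimeIdeal A)} (hV : IsOpen V)
    (h : top A ∈ V) (p : PrimeIdeal A) : p ∈ V := by
  obtain ⟨g, hg, hg'⟩ := exists_basicOpen hV h
  exact hg' p (p.not_mem_of_isUnit (not_not.1 hg))

lemma isEmpty_of_subsingleton [Subsingleton A] : IsEmpty (PrimeIdeal A) :=
  ⟨fun p => p.one_notMem (Subsingleton.elim (0 : A) 1 ▸ p.zero_mem)⟩

/-- The localization of `A` at the prime ideal `p`. -/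
abbrev Loc (p : PrimeIdeal A) : Type u := Localization p.compl

/-- The fraction `a / s` in the localization at `p`, for `s` not in `p`. -/
def frac (p : PrimeIdeal A) (a s : A) (hs : s ∉ p) : p.Loc := Localization.mk a ⟨s, hs⟩

lemma frac_surj (p : PrimeIdeal A) (x : p.Loc) : ∃ (a s : A) (hs : s ∉ p), x = p.frac a s hs := by
  induction x using Localization.induction_on with
  | H y => exact ⟨y.1, y.2.1, y.2.2, rfl⟩

lemma frac_eq_iff (p : PrimeIdeal A) {a b s t : A} (hs : s ∉ p) (ht : t ∉ p) :
    p.frac a s hs = p.frac b t ht ↔ ∃ c, c ∉ p ∧ c * (t * a) = c * (s * b) := by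
  unfold frac
  rw [Localization.mk_eq_mk_iff, Localization.r_iff_exists]
  exact ⟨fun ⟨c, hc⟩ => ⟨c.1, c.2, hc⟩, fun ⟨c, hc, h⟩ => ⟨⟨c, hc⟩, h⟩⟩

lemma frac_mul (p : PrimeIdeal A) {a b s t : A} (hs : s ∉ p) (ht : t ∉ p) :
    p.frac a s hs * p.frac b t ht = p.frac (a * b) (s * t) (p.mul_nmem hs ht) :=
  Localization.mk_mul ..

lemma frac_zero (p : PrimeIdeal A) {s : A} (hs : s ∉ p) : p.frac 0 s hs = 0 :=
  Localization.mk_zero _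

lemma frac_one (p : PrimeIdeal A) : p.frac 1 1 p.one_nmem = 1 := Localization.mk_one

lemma frac_one_mul (p : PrimeIdeal A) (a b : A) :
    p.frac (a * b) 1 p.one_nmem = p.frac a 1 p.one_nmem * p.frac b 1 p.one_nmem := by
  rw [frac_mul, frac_eq_iff]
  exact ⟨1, p.one_nmem, by simp⟩

lemma isUnit_frac_iff (p : PrimeIdeal A) {a : A} : IsUnit (p.frac a 1 p.one_nmem) ↔ a ∉ p := by
  constructor
  · intro h ha
    obtain ⟨x, hx⟩ := h.exists_right_inv
    obtain ⟨b, s, hs, rfl⟩ := p.frac_surj x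
    rw [frac_mul, ← frac_one, frac_eq_iff] at hx
    obtain ⟨c, hc, h⟩ := hx
    have h1 : c * (1 * (a * b)) ∈ p :=
      p.mul_mem _ (p.mul_mem _ (p.mul_mem_iff.2 (Or.inl ha)))
    rw [h] at h1
    simp only [one_mul, mul_one] at h1
    exact (p.mem_or_mem h1).elim hc hs
  · intro h
    refine IsUnit.of_mul_eq_one (p.frac 1 a h) ?_
    rw [frac_mul, ← frac_one, frac_eq_iff]
    exact ⟨1, p.one_nmem, by simp⟩

/-- The morphism induced by `f` on the localizations at a prime ideal and at its pullback. -/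
def locMap (f : A →*₀ B) (q : PrimeIdeal B) : (q.comap f).Loc →*₀ q.Loc where
  toFun x := Localization.liftOn x (fun a s => q.frac (f a) (f s) ((mem_comap f q).not.1 ((mem_compl _).1 s.2))) fun {a c b d} h => by
    obtain ⟨e, he⟩ := Localization.r_iff_exists.1 h
    refine (frac_eq_iff q _ _).2 ⟨f e, (mem_compl _).1 e.2, by simpa only [map_mul] using congrArg f he⟩
  map_zero' := by
    rw [Localization.liftOn_zero]
    simp only [map_zero]
    exact frac_zero _ _
  map_one' := by
    rw [← Localization.mk_one, Localization.liftOn_mk]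
    simp only [map_one, OneMemClass.coe_one]
    exact frac_one _
  map_mul' x y := by
    obtain ⟨a, s, hs, rfl⟩ := frac_surj _ x
    obtain ⟨b, t, ht, rfl⟩ := frac_surj _ y
    rw [frac_mul]
    refine Eq.trans ?_ (frac_mul q (a := f a) (b := f b) (s := f s) (t := f t) hs ht).symm
    exact (frac_eq_iff q _ _).2 ⟨1, q.one_nmem, by simp only [map_mul]⟩

lemma locMap_frac (f : A →*₀ B) (q : PrimeIdeal B) {a s : A} (hs : s ∉ q.comap f) :
    locMap f q (frac _ a s hs) = q.frac (f a) (f s) hs := rfl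

end PrimeIdeal

open PrimeIdeal in
/-- A family of elements of the localizations of `A` that is locally given by a fraction. -/
def isLocallyFraction (A : PMon.{u}) :
    TopCat.LocalPredicate (X := TopCat.of (PrimeIdeal A)) fun p : PrimeIdeal A => p.Loc where
  pred {V} f := ∀ x : V, ∃ W : Opens (PrimeIdeal A), x.1 ∈ W ∧ ∃ i : W ≤ V, ∃ a s : A,
    ∀ y : W, ∃ hs : s ∉ y.1, f ⟨y.1, i y.2⟩ = y.1.frac a s hs
  res {U V} i f hf x := by
    obtain ⟨W, hxW, j, a, s, h⟩ := hf ⟨x.1, i.le x.2⟩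
    exact ⟨W ⊓ U, ⟨hxW, x.2⟩, inf_le_right, a, s, fun y => h ⟨y.1, y.2.1⟩⟩
  locality {V} f hf x := by
    obtain ⟨U, hxU, i, h⟩ := hf x
    obtain ⟨W, hxW, j, a, s, h⟩ := h ⟨x.1, hxU⟩
    exact ⟨W, hxW, j.trans i.le, a, s, h⟩

/-- The sections over `V` of the structure sheaf of `MSpec A`: the families of elements of the
localizations at the points of `V` that are locally given by a fraction. -/
def MSpecSections (A : PMon.{u}) (V : Opens (PrimeIdeal A)) : Type u :=
  {f : ∀ p : V, p.1.Loc // (isLocallyFraction A).pred f}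

namespace MSpecSections

open PrimeIdeal

variable {A B : PMon.{u}}

instance (V : Opens (PrimeIdeal A)) : CommMonoidWithZero (MSpecSections A V) where
  mul s t := ⟨fun p => s.1 p * t.1 p, fun x => by
    obtain ⟨W, hW, i, a, b, h⟩ := s.2 x
    obtain ⟨W', hW', i', a', b', h'⟩ := t.2 x
    refine ⟨W ⊓ W', ⟨hW, hW'⟩, inf_le_left.trans i, a * a', b * b', fun y => ?_⟩
    obtain ⟨hs, e⟩ := h ⟨y.1, y.2.1⟩
    obtain ⟨hs', e'⟩ := h' ⟨y.1, y.2.2⟩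
    exact ⟨y.1.mul_nmem hs hs', by rw [← frac_mul _ hs hs', ← e, ← e']⟩⟩
  one := ⟨fun _ => 1, fun x => ⟨V, x.2, le_rfl, 1, 1, fun y => ⟨y.1.one_nmem, y.1.frac_one.symm⟩⟩⟩
  zero := ⟨fun _ => 0, fun x => ⟨V, x.2, le_rfl, 0, 1, fun y =>
    ⟨y.1.one_nmem, (y.1.frac_zero _).symm⟩⟩⟩
  mul_assoc _ _ _ := Subtype.ext (funext fun _ => mul_assoc _ _ _)
  mul_comm _ _ := Subtype.ext (funext fun _ => mul_comm _ _)
  one_mul _ := Subtype.ext (funext fun _ => one_mul _)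
  mul_one _ := Subtype.ext (funext fun _ => mul_one _)
  zero_mul _ := Subtype.ext (funext fun _ => zero_mul _)
  mul_zero _ := Subtype.ext (funext fun _ => mul_zero _)

/-- Restriction of sections. -/
def res {V W : Opens (PrimeIdeal A)} (i : V ≤ W) : MSpecSections A W →*₀ MSpecSections A V where
  toFun s := ⟨fun p => s.1 ⟨p.1, i p.2⟩, (isLocallyFraction A).res (homOfLE i) s.1 s.2⟩
  map_zero' := rfl
  map_one' := rfl
  map_mul' _ _ := rfl

end MSpecSections

/-- The spectrum of a pointed monoid, with its structure sheaf of pointed monoids. -/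
def MSpec (A : PMon.{u}) : SheafedSpace PMon.{u} where
  carrier := TopCat.of (PrimeIdeal A)
  presheaf :=
    { obj := fun V => PMon.of (MSpecSections A V.unop)
      map := fun i => PMon.ofHom (MSpecSections.res i.unop.le) }
  IsSheaf := Presheaf.isSheaf_of_isSheaf_comp _ _ (forget PMon.{u})
    (TopCat.subsheafToTypes (isLocallyFraction A)).property

/-- The morphism `f : A → B` exhibits `B` as the localization `A[h⁻¹]`. -/
structure IsAway {A B : Type u} [CommMonoidWithZero A] [CommMonoidWithZero B]
    (h : A) (f : A →*₀ B) : Prop where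
  isUnit : IsUnit (f h)
  surj : ∀ z : B, ∃ (n : ℕ) (a : A), z * f h ^ n = f a
  eq : ∀ {x y : A}, f x = f y → ∃ n : ℕ, h ^ n * x = h ^ n * y

lemma exists_isAway (A : PMon.{u}) (h : A) : ∃ (B : PMon.{u}) (f : A →*₀ B), IsAway h f := by
  let F := Localization.monoidOf (Submonoid.powers h)
  refine ⟨PMon.of (Localization (Submonoid.powers h)),
    { toFun := F, map_zero' := map_zero F, map_one' := map_one F, map_mul' := map_mul F }, ?_, ?_, ?_⟩
  · exact F.map_units ⟨h, Submonoid.mem_powers h⟩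
  · intro z
    obtain ⟨⟨a, ⟨_, n, rfl⟩⟩, e⟩ := F.surj z
    exact ⟨n, a, Eq.trans (congrArg (z * ·) (map_pow F h n).symm) e⟩
  · intro x y e
    obtain ⟨⟨_, n, rfl⟩, e⟩ := F.exists_of_eq e
    exact ⟨n, e⟩

namespace MSpec

open PrimeIdeal

variable {A B : PMon.{u}}

/-- The map on sections induced by a morphism of pointed monoids. -/
def mapSections (f : A →*₀ B) (V : Opens (PrimeIdeal A)) (W : Opens (PrimeIdeal B))
    (hW : ∀ q ∈ W, q.comap f ∈ V) : MSpecSections A V →*₀ MSpecSections B W where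
  toFun s := ⟨fun q => locMap f q.1 (s.1 ⟨q.1.comap f, hW q.1 q.2⟩), fun x => by
    obtain ⟨W', hxW', i, a, b, h⟩ := s.2 ⟨x.1.comap f, hW x.1 x.2⟩
    refine ⟨⟨comap f ⁻¹' W', W'.isOpen.preimage (continuous_comap f)⟩ ⊓ W, ⟨hxW', x.2⟩,
      inf_le_right, f a, f b, fun y => ?_⟩
    obtain ⟨hs, e⟩ := h ⟨y.1.comap f, y.2.1⟩
    exact ⟨hs, by rw [← locMap_frac, ← e]⟩⟩
  map_zero' := Subtype.ext (funext fun _ => map_zero _)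
  map_one' := Subtype.ext (funext fun _ => map_one _)
  map_mul' _ _ := Subtype.ext (funext fun _ => map_mul _ _ _)

/-- The morphism of monoidal spaces induced by a morphism of pointed monoids. -/
def map (f : A →*₀ B) : MSpec B ⟶ MSpec A := InducedCategory.homMk
  { base := TopCat.ofHom ⟨comap f, continuous_comap f⟩
    c :=
      { app := fun V => PMon.ofHom (mapSections f V.unop _ fun _ hq => hq)
        naturality := fun _ _ _ => rfl } }

lemma map_apply (f : A →*₀ B) (q : PrimeIdeal B) : (map f).hom.base q = q.comap f := rfl

variable {h : A} {f : A →*₀ B}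

lemma nmem_comap_of_isAway (hf : IsAway h f) (q : PrimeIdeal B) : h ∉ q.comap f :=
  q.not_mem_of_isUnit hf.isUnit

lemma pow_nmem {p : PrimeIdeal A} (hp : h ∉ p) (n : ℕ) : h ^ n ∉ p := by
  induction n with
  | zero => rw [pow_zero]; exact p.one_nmem
  | succ n ih => rw [pow_succ]; exact p.mul_nmem ih hp

lemma mem_iff_of_eq (hf : IsAway h f) (q : PrimeIdeal B) {z : B} {n : ℕ} {a : A}
    (e : z * f h ^ n = f a) : z ∈ q ↔ a ∈ q.comap f := by
  rw [mem_comap, ← e, mul_mem_iff]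
  exact ⟨Or.inl, fun h => h.elim id fun h => (q.not_mem_of_isUnit (hf.isUnit.pow n) h).elim⟩

lemma exists_comap_eq (hf : IsAway h f) (p : PrimeIdeal A) (hp : h ∉ p) :
    ∃ q : PrimeIdeal B, q.comap f = p := by
  have key : ∀ {z : B} {n m : ℕ} {a b : A}, z * f h ^ n = f a → z * f h ^ m = f b →
      a ∈ p → b ∈ p := by
    intro z n m a b ha hb hap
    have : f (h ^ m * a) = f (h ^ n * b) := by
      simp only [map_mul, map_pow, ← ha, ← hb]
      ac_rfl
    obtain ⟨k, hk⟩ := hf.eq this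
    have h1 : h ^ k * (h ^ n * b) ∈ p := hk ▸ p.mul_mem _ (p.mul_mem _ hap)
    exact (p.mem_or_mem ((p.mem_or_mem h1).resolve_left (pow_nmem hp k))).resolve_left
      (pow_nmem hp n)
  have fmem : ∀ a : A, (∃ (n : ℕ) (b : A), f a * f h ^ n = f b ∧ b ∈ p) ↔ a ∈ p := fun a =>
    ⟨fun ⟨n, b, e, hb⟩ => key e (m := 0) (by rw [pow_zero, mul_one]) hb,
      fun ha => ⟨0, a, by rw [pow_zero, mul_one], ha⟩⟩
  refine ⟨{
    carrier := {z | ∃ (n : ℕ) (a : A), z * f h ^ n = f a ∧ a ∈ p}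
    zero_mem := ⟨0, 0, by rw [pow_zero, mul_one, map_zero], p.zero_mem⟩
    mul_mem := ?_
    one_notMem := ?_
    mem_or_mem := ?_ }, ?_⟩
  · rintro z x ⟨n, a, e, ha⟩
    obtain ⟨m, b, e'⟩ := hf.surj z
    refine ⟨m + n, b * a, ?_, p.mul_mem _ ha⟩
    rw [map_mul, ← e, ← e', pow_add]
    ac_rfl
  · intro hc
    rw [← map_one f] at hc
    exact p.one_nmem ((fmem 1).1 hc)
  · rintro z w ⟨n, a, e, ha⟩
    obtain ⟨m, b, eb⟩ := hf.surj z
    obtain ⟨k, c, ec⟩ := hf.surj w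
    have : z * w * f h ^ (m + k) = f (b * c) := by
      rw [map_mul, ← eb, ← ec, pow_add]
      ac_rfl
    exact (p.mem_or_mem (key e this ha)).imp (fun hb => ⟨m, b, eb, hb⟩) (fun hc => ⟨k, c, ec, hc⟩)
  · ext a
    exact fmem a

lemma comap_injective (hf : IsAway h f) : Function.Injective (comap f) := by
  intro q q' e
  refine SetLike.ext fun z => ?_
  obtain ⟨n, a, ha⟩ := hf.surj z
  rw [mem_iff_of_eq hf q ha, mem_iff_of_eq hf q' ha, e]

lemma isOpenEmbedding_comap (hf : IsAway h f) : Topology.IsOpenEmbedding (comap f) := by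
  refine .of_continuous_injective_isOpenMap (continuous_comap f) (comap_injective hf) ?_
  intro V hV
  refine isOpen_iff_forall_mem_open.2 ?_
  rintro _ ⟨q, hq, rfl⟩
  obtain ⟨z, hz, hz'⟩ := exists_basicOpen hV hq
  obtain ⟨n, a, ha⟩ := hf.surj z
  refine ⟨_, ?_, (basicOpen (h * a)).isOpen, (q.comap f).mul_nmem (nmem_comap_of_isAway hf q)
    ((mem_iff_of_eq hf q ha).not.1 hz)⟩
  intro p hp
  have hp' : h * a ∉ p := hp
  rw [mul_mem_iff, not_or] at hp'
  obtain ⟨q', rfl⟩ := exists_comap_eq hf p hp'.1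
  exact ⟨q', hz' _ ((mem_iff_of_eq hf q' ha).not.2 hp'.2), rfl⟩

lemma locMap_bijective (hf : IsAway h f) (q : PrimeIdeal B) :
    Function.Bijective (locMap f q) := by
  constructor
  · intro x y e
    obtain ⟨a, s, hs, rfl⟩ := frac_surj _ x
    obtain ⟨b, t, ht, rfl⟩ := frac_surj _ y
    rw [locMap_frac, locMap_frac] at e
    obtain ⟨c, hc, e⟩ := (frac_eq_iff _ _ _).1 e
    obtain ⟨n, d, hd⟩ := hf.surj c
    have : f (d * (t * a)) = f (d * (s * b)) := by
      have := congrArg (· * f h ^ n) e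
      simp only [map_mul, ← hd]
      calc c * f h ^ n * (f t * f a) = c * (f t * f a) * f h ^ n := by ac_rfl
        _ = c * (f s * f b) * f h ^ n := this
        _ = _ := by ac_rfl
    obtain ⟨m, hm⟩ := hf.eq this
    refine (frac_eq_iff _ _ _).2 ⟨h ^ m * d, PrimeIdeal.mul_nmem _
      (pow_nmem (nmem_comap_of_isAway hf q) m) ((mem_iff_of_eq hf q hd).not.1 hc), ?_⟩
    rw [mul_assoc, hm, mul_assoc]
  · intro x
    obtain ⟨z, w, hw, rfl⟩ := frac_surj _ x
    obtain ⟨n, a, ha⟩ := hf.surj z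
    obtain ⟨m, s, hs⟩ := hf.surj w
    refine ⟨frac _ (a * h ^ m) (s * h ^ n) (PrimeIdeal.mul_nmem _
      ((mem_iff_of_eq hf q hs).not.1 hw) (pow_nmem (nmem_comap_of_isAway hf q) n)), ?_⟩
    rw [locMap_frac]
    refine (frac_eq_iff _ _ _).2 ⟨1, q.one_nmem, ?_⟩
    simp only [map_mul, map_pow, ← ha, ← hs]
    ac_rfl

lemma mapSections_bijective (hf : IsAway h f) (V : Opens (PrimeIdeal A)) (W : Opens (PrimeIdeal B))
    (hW : ∀ q ∈ W, q.comap f ∈ V) (hV : ∀ p ∈ V, ∃ q ∈ W, q.comap f = p) :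
    Function.Bijective (mapSections f V W hW) := by
  constructor
  · intro s t e
    refine Subtype.ext (funext fun ⟨p, hp⟩ => ?_)
    obtain ⟨q, hq, rfl⟩ := hV p hp
    exact (locMap_bijective hf q).1 (congrFun (congrArg Subtype.val e) ⟨q, hq⟩)
  · intro t
    choose g hg hg' using hV
    have ex : ∀ p : V, ∃ x : p.1.Loc, ∀ (q : PrimeIdeal B) (hq : q ∈ W) (e : q.comap f = p.1),
        locMap f q (e ▸ x) = t.1 ⟨q, hq⟩ := by
      rintro ⟨p, hp⟩
      obtain ⟨q₀, hq₀, rfl⟩ : ∃ q ∈ W, q.comap f = p := ⟨g p hp, hg p hp, hg' p hp⟩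
      obtain ⟨x, hx⟩ := (locMap_bijective hf q₀).2 (t.1 ⟨q₀, hq₀⟩)
      refine ⟨x, fun q hq e => ?_⟩
      obtain rfl := comap_injective hf e
      exact hx
    choose s hs using ex
    have hs' : ∀ q : W, locMap f q.1 (s ⟨q.1.comap f, hW q.1 q.2⟩) = t.1 q := fun q =>
      hs ⟨q.1.comap f, hW q.1 q.2⟩ q.1 q.2 rfl
    refine ⟨⟨s, ?_⟩, Subtype.ext (funext hs')⟩
    rintro ⟨p, hp⟩
    obtain ⟨q, hq, rfl⟩ : ∃ q ∈ W, q.comap f = p := ⟨g p hp, hg p hp, hg' p hp⟩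
    obtain ⟨W', hqW', i, z, w, H⟩ := t.2 ⟨q, hq⟩
    obtain ⟨n, a, ha⟩ := hf.surj z
    obtain ⟨m, b, hb⟩ := hf.surj w
    refine ⟨⟨comap f '' W', (isOpenEmbedding_comap hf).isOpenMap _ W'.isOpen⟩, ⟨q, hqW', rfl⟩, ?_,
      a * h ^ m, b * h ^ n, ?_⟩
    · rintro _ ⟨q', hq', rfl⟩
      exact hW _ (i hq')
    · rintro ⟨_, q', hq', rfl⟩
      obtain ⟨hw, e⟩ := H ⟨q', hq'⟩
      have hc : b * h ^ n ∉ q'.comap f := PrimeIdeal.mul_nmem _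
        ((mem_iff_of_eq hf q' hb).not.1 hw) (pow_nmem (nmem_comap_of_isAway hf q') n)
      refine ⟨hc, (locMap_bijective hf q').1 ?_⟩
      rw [locMap_frac]
      refine (hs' ⟨q', i hq'⟩).trans (e.trans ?_)
      refine (frac_eq_iff _ _ _).2 ⟨1, q'.one_nmem, ?_⟩
      simp only [map_mul, map_pow, ← ha, ← hb]
      ac_rfl

lemma isOpenImmersion_map (hf : IsAway h f) : SheafedSpace.IsOpenImmersion (map f) where
  base_open := isOpenEmbedding_comap hf
  c_iso W := PMon.isIso_of_bijective _ <| by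
    refine mapSections_bijective hf _ _ (fun _ hq => hq) ?_
    rintro _ ⟨q, hq, rfl⟩
    exact ⟨q, ⟨q, hq, rfl⟩, rfl⟩

/-- The canonical map from `A` to the sections of the structure sheaf of `MSpec A`. -/
def toSections (A : PMon.{u}) (V : Opens (PrimeIdeal A)) : A →*₀ MSpecSections A V where
  toFun a := ⟨fun p => p.1.frac a 1 p.1.one_nmem, fun x =>
    ⟨V, x.2, le_rfl, a, 1, fun y => ⟨y.1.one_nmem, rfl⟩⟩⟩
  map_zero' := Subtype.ext (funext fun p => p.1.frac_zero _)
  map_one' := Subtype.ext (funext fun p => p.1.frac_one)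
  map_mul' a b := Subtype.ext (funext fun p => p.1.frac_one_mul a b)

lemma toSections_bijective (A : PMon.{u}) : Function.Bijective (toSections A ⊤) := by
  rcases subsingleton_or_nontrivial A with hA | hA
  · have := isEmpty_of_subsingleton (A := A)
    refine ⟨fun a b _ => Subsingleton.elim a b, fun s => ⟨0, Subtype.ext (funext fun p => ?_)⟩⟩
    exact (this.false p.1).elim
  · constructor
    · intro a b e
      have e1 : (top A).frac a 1 _ = (top A).frac b 1 _ :=
        congrFun (congrArg Subtype.val e) ⟨top A, trivial⟩
      obtain ⟨c, hc, e2⟩ := (frac_eq_iff _ _ _).1 e1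
      rw [one_mul, one_mul] at e2
      exact (not_not.1 hc : IsUnit c).mul_left_cancel e2
    · intro s
      obtain ⟨W, hW, i, a, b, H⟩ := s.2 ⟨top A, trivial⟩
      obtain ⟨hb, -⟩ := H ⟨top A, hW⟩
      obtain ⟨c, hc⟩ := (not_not.1 hb : IsUnit b).exists_left_inv
      refine ⟨c * a, Subtype.ext (funext fun p => ?_)⟩
      obtain ⟨hp, e⟩ := H ⟨p.1, eq_univ_of_top_mem W.isOpen hW p.1⟩
      refine Eq.trans ?_ e.symm
      refine (frac_eq_iff _ _ _).2 ⟨1, p.1.one_nmem, ?_⟩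
      rw [one_mul, one_mul, one_mul, ← mul_assoc, mul_comm b c, hc, one_mul]

end MSpec

namespace MonoidalSpace

open PrimeIdeal

/-- An open subset `U` of a monoidal space is affine if the open subspace `U` is isomorphic, as a
monoidal space, to the spectrum of a pointed monoid. -/
def IsAffineOpen (X : SheafedSpace PMon.{u}) (U : Opens X) : Prop :=
  ∃ A : PMon.{u}, Nonempty (X.restrict U.isOpenEmbedding ≅ MSpec A)

variable {X : SheafedSpace PMon.{u}}

/-- The restriction maps of the structure sheaf. -/
def res {U V : Opens X} (i : V ≤ U) : X.presheaf.obj (op U) →*₀ X.presheaf.obj (op V) :=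
  PMon.hom (X.presheaf.map (homOfLE i).op)

lemma res_res {U V W : Opens X} (i : V ≤ U) (j : W ≤ V) (s : X.presheaf.obj (op U)) :
    res j (res i s) = res (j.trans i) s :=
  (ConcreteCategory.congr_hom (X.presheaf.map_comp (homOfLE i).op (homOfLE j).op) s).symm

/-- The germ of the section `s` at `x` is invertible. -/
def IsUnitAt {U : Opens X} (s : X.presheaf.obj (op U)) (x : X) : Prop :=
  ∃ (V : Opens X) (i : V ≤ U), x ∈ V ∧ IsUnit (res i s)

/-- A morphism `f : MSpec A → X` identifying `MSpec A` with the open subspace `U`. -/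
structure IsChart (U : Opens X) {A : PMon.{u}} (f : MSpec A ⟶ X) : Prop where
  isOpenImmersion : SheafedSpace.IsOpenImmersion f
  range_eq : Set.range f.hom.base = U

lemma isAffineOpen_iff {U : Opens X} :
    IsAffineOpen X U ↔ ∃ (A : PMon.{u}) (f : MSpec A ⟶ X), IsChart U f := by
  constructor
  · rintro ⟨A, ⟨e⟩⟩
    refine ⟨A, e.inv ≫ X.ofRestrict U.isOpenEmbedding, inferInstance, ?_⟩
    have hs : Function.Surjective e.inv.hom.base := by
      intro x
      refine ⟨e.hom.hom.base x, ?_⟩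
      exact ConcreteCategory.congr_hom
        (congrArg (fun φ : X.restrict U.isOpenEmbedding ⟶ X.restrict U.isOpenEmbedding =>
          φ.hom.base) e.hom_inv_id) x
    ext x
    constructor
    · rintro ⟨p, rfl⟩
      exact Subtype.property (p := (· ∈ U)) (e.inv.hom.base p)
    · intro hx
      obtain ⟨p, hp⟩ := hs ⟨x, hx⟩
      exact ⟨p, congrArg (Subtype.val : U → X) hp⟩
  · rintro ⟨A, f, hf, hU⟩
    have hr : Set.range (X.ofRestrict U.isOpenEmbedding).hom.base = Set.range f.hom.base := by
      rw [hU]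
      exact Subtype.range_coe
    exact ⟨A, ⟨SheafedSpace.isoMk (PresheafedSpace.IsOpenImmersion.isoOfRangeEq
      (X.ofRestrict U.isOpenEmbedding).hom f.hom hr)⟩⟩

/-- The open subset of `MSpec A` corresponding to an open subset of `X`. -/
def preim {A : PMon.{u}} (f : MSpec A ⟶ X) (V : Opens X) : Opens (PrimeIdeal A) :=
  (Opens.map f.hom.base).obj V

/-- The map on sections of a morphism `MSpec A → X`. -/
def pull {A : PMon.{u}} (f : MSpec A ⟶ X) (V : Opens X) :
    X.presheaf.obj (op V) →*₀ MSpecSections A (preim f V) :=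
  PMon.hom (f.hom.c.app (op V))

lemma pull_res {A : PMon.{u}} (f : MSpec A ⟶ X) {U V : Opens X} (i : V ≤ U)
    (s : X.presheaf.obj (op U)) :
    pull f V (res i s) = MSpecSections.res (fun _ h => i h) (pull f U s) :=
  ConcreteCategory.congr_hom (f.hom.c.naturality (homOfLE i).op) s

namespace IsChart

variable {U V W : Opens X} {A B : PMon.{u}} {f : MSpec A ⟶ X}

lemma injective (hf : IsChart U f) : Function.Injective f.hom.base :=
  hf.isOpenImmersion.base_open.injective

lemma apply_mem (hf : IsChart U f) (p : PrimeIdeal A) : f.hom.base p ∈ U := by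
  have : f.hom.base p ∈ (U : Set X) := hf.range_eq ▸ ⟨p, rfl⟩
  exact this

lemma exists_eq (hf : IsChart U f) {x : X} (hx : x ∈ U) : ∃ p : PrimeIdeal A, f.hom.base p = x := by
  have : x ∈ Set.range f.hom.base := hf.range_eq ▸ hx
  exact this

/-- The image in `X` of an open subset of the spectrum. -/
def image (hf : IsChart U f) (V : Opens (PrimeIdeal A)) : Opens X :=
  ⟨f.hom.base '' (V : Set (PrimeIdeal A)), hf.isOpenImmersion.base_open.isOpenMap _ V.isOpen⟩

lemma image_preim (hf : IsChart U f) {V : Opens X} (i : V ≤ U) : hf.image (preim f V) = V := by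
  ext x
  constructor
  · rintro ⟨p, hp, rfl⟩
    exact hp
  · intro hx
    obtain ⟨p, rfl⟩ := hf.exists_eq (i hx)
    exact ⟨p, hx, rfl⟩

lemma preim_image (hf : IsChart U f) (V : Opens (PrimeIdeal A)) : preim f (hf.image V) = V := by
  ext p
  constructor
  · rintro ⟨q, hq, e⟩
    exact hf.injective e ▸ hq
  · exact fun hp => ⟨p, hp, rfl⟩

lemma image_le (hf : IsChart U f) (V : Opens (PrimeIdeal A)) : hf.image V ≤ U := by
  rintro _ ⟨q, hq, rfl⟩
  exact hf.apply_mem q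

lemma pull_bijective (hf : IsChart U f) {V : Opens X} (i : V ≤ U) :
    Function.Bijective (pull f V) := by
  obtain ⟨W, rfl⟩ : ∃ W, V = hf.image W := ⟨_, (hf.image_preim i).symm⟩
  have : IsIso (f.hom.c.app (op (hf.image W))) := hf.isOpenImmersion.c_iso W
  exact PMon.bijective_of_isIso (f.hom.c.app (op (hf.image W)))

lemma isUnit_iff (hf : IsChart U f) {V : Opens X} (i : V ≤ U) {s : X.presheaf.obj (op V)} :
    IsUnit (pull f V s) ↔ IsUnit s := by
  refine ⟨fun h => ?_, fun h => h.map _⟩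
  obtain ⟨t, ht⟩ := h.exists_right_inv
  obtain ⟨t, rfl⟩ := (hf.pull_bijective i).2 t
  refine IsUnit.of_mul_eq_one t ((hf.pull_bijective i).1 ?_)
  rw [map_mul, ht, map_one]

lemma preim_self (hf : IsChart U f) : preim f U = ⊤ := by
  ext p
  exact iff_of_true (hf.apply_mem p) trivial

lemma toSections_bijective (hf : IsChart U f) :
    Function.Bijective (MSpec.toSections A (preim f U)) := by
  rw [hf.preim_self]
  exact MSpec.toSections_bijective A

/-- A chart identifies the pointed monoid with the sections over its image. -/
noncomputable def equiv (hf : IsChart U f) : A ≃* X.presheaf.obj (op U) :=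
  (MulEquiv.ofBijective _ hf.toSections_bijective).trans
    (MulEquiv.ofBijective _ (hf.pull_bijective le_rfl)).symm

lemma pull_equiv (hf : IsChart U f) (a : A) :
    pull f U (hf.equiv a) = MSpec.toSections A (preim f U) a :=
  (MulEquiv.ofBijective _ (hf.pull_bijective le_rfl)).apply_symm_apply _

lemma isUnitAt_iff (hf : IsChart U f) (a : A) (p : PrimeIdeal A) :
    IsUnitAt (hf.equiv a) (f.hom.base p) ↔ a ∉ p := by
  constructor
  · rintro ⟨V, i, hV, hu⟩
    replace hu := hu.map (pull f V)
    rw [pull_res, hf.pull_equiv] at hu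
    obtain ⟨t, ht⟩ := hu.exists_right_inv
    exact (p.isUnit_frac_iff).1
      (IsUnit.of_mul_eq_one (t.1 ⟨p, hV⟩) (congrFun (congrArg Subtype.val ht) ⟨p, hV⟩))
  · intro ha
    refine ⟨hf.image (basicOpen a), hf.image_le _, ⟨p, ha, rfl⟩, ?_⟩
    rw [← hf.isUnit_iff (hf.image_le _), pull_res, hf.pull_equiv]
    have hm : ∀ q ∈ preim f (hf.image (basicOpen a)), a ∉ q := by
      intro q hq
      rw [hf.preim_image] at hq
      exact hq
    refine IsUnit.of_mul_eq_one ⟨fun q => q.1.frac 1 a (hm q.1 q.2), fun x =>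
      ⟨_, x.2, le_rfl, 1, a, fun y => ⟨hm y.1 y.2, rfl⟩⟩⟩ (Subtype.ext (funext fun q => ?_))
    refine (frac_mul _ _ _).trans (Eq.trans ?_ (frac_one _))
    exact (frac_eq_iff _ _ _).2 ⟨1, q.1.one_nmem, by simp⟩

/-- Restriction of a chart to a principal open subset. -/
lemma comp (hf : IsChart U f) {h : A} {φ : A →*₀ B} (hφ : IsAway h φ) :
    IsChart (hf.image (basicOpen h)) (MSpec.map φ ≫ f) := by
  have := hf.isOpenImmersion
  have := MSpec.isOpenImmersion_map hφ
  refine ⟨inferInstance, ?_⟩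
  ext x
  constructor
  · rintro ⟨q, rfl⟩
    exact ⟨q.comap φ, MSpec.nmem_comap_of_isAway hφ q, rfl⟩
  · rintro ⟨p, hp, rfl⟩
    obtain ⟨q, rfl⟩ := MSpec.exists_comap_eq hφ p hp
    exact ⟨q, rfl⟩

lemma equiv_comp (hf : IsChart U f) {h : A} {φ : A →*₀ B} (hφ : IsAway h φ) (a : A) :
    (hf.comp hφ).equiv (φ a) = res (hf.image_le _) (hf.equiv a) := by
  refine ((hf.comp hφ).pull_bijective le_rfl).1 ?_
  rw [pull_equiv]
  have : pull (MSpec.map φ ≫ f) (hf.image (basicOpen h)) (res (hf.image_le _) (hf.equiv a)) =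
      MSpec.mapSections φ _ _ (fun _ h => h)
        (pull f (hf.image (basicOpen h)) (res (hf.image_le _) (hf.equiv a))) := rfl
  rw [this, pull_res, hf.pull_equiv]
  refine Subtype.ext (funext fun q => ?_)
  exact (frac_eq_iff _ _ _).2 ⟨1, q.1.one_nmem, by simp⟩

/-- Every affine open subset of an affine open subset is principal. -/
lemma exists_basicOpen (hf : IsChart U f) (hW : IsAffineOpen X W) (i : W ≤ U) :
    ∃ h : A, hf.image (basicOpen h) = W := by
  obtain ⟨B, g, hg⟩ := isAffineOpen_iff.1 hW
  rcases subsingleton_or_nontrivial B with hB | hB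
  · have := isEmpty_of_subsingleton (A := B)
    refine ⟨0, ?_⟩
    ext x
    constructor
    · rintro ⟨p, hp, rfl⟩
      exact (hp p.zero_mem).elim
    · intro hx
      obtain ⟨q, rfl⟩ := hg.exists_eq hx
      exact (this.false q).elim
  · obtain ⟨p, hp⟩ := hf.exists_eq (i (hg.apply_mem (top B)))
    obtain ⟨h, hh, hh'⟩ := PrimeIdeal.exists_basicOpen (preim f W).isOpen (p := p)
      (show f.hom.base p ∈ W by rw [hp]; exact hg.apply_mem _)
    refine ⟨h, ?_⟩
    ext x
    constructor
    · rintro ⟨q, hq, rfl⟩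
      exact hh' q hq
    · intro hx
      obtain ⟨q, rfl⟩ := hg.exists_eq hx
      exact eq_univ_of_top_mem (preim g (hf.image (basicOpen h))).isOpen
        (show g.hom.base (top B) ∈ hf.image (basicOpen h) from ⟨p, hh, hp⟩) q

end IsChart

variable {U V W : Opens X}

/-- The restriction map between affine open subsets is a localization. -/
lemma exists_isAway (hU : IsAffineOpen X U) (hW : IsAffineOpen X W) (i : W ≤ U) :
    ∃ h : X.presheaf.obj (op U), IsAway h (res i) := by
  obtain ⟨A, f, hf⟩ := isAffineOpen_iff.1 hU
  obtain ⟨h, rfl⟩ := hf.exists_basicOpen hW i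
  obtain ⟨B, φ, hφ⟩ := exists_isAway A h
  refine ⟨hf.equiv h, ?_, ?_, ?_⟩
  · rw [← hf.equiv_comp hφ]
    exact hφ.isUnit.map _
  · intro z
    obtain ⟨z, rfl⟩ := (hf.comp hφ).equiv.surjective z
    obtain ⟨n, a, e⟩ := hφ.surj z
    refine ⟨n, hf.equiv a, ?_⟩
    rw [← hf.equiv_comp hφ, ← hf.equiv_comp hφ, ← map_pow, ← map_mul, e]
  · intro x y e
    obtain ⟨a, rfl⟩ := hf.equiv.surjective x
    obtain ⟨b, rfl⟩ := hf.equiv.surjective y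
    rw [← hf.equiv_comp hφ, ← hf.equiv_comp hφ] at e
    obtain ⟨n, e⟩ := hφ.eq ((hf.comp hφ).equiv.injective e)
    refine ⟨n, ?_⟩
    rw [← map_pow, ← map_mul, ← map_mul, e]

lemma isAffineOpen_inf (hU : IsAffineOpen X U) (hV : IsAffineOpen X V) (hW : IsAffineOpen X W)
    (i : U ≤ W) (j : V ≤ W) : IsAffineOpen X (U ⊓ V) := by
  obtain ⟨A, f, hf⟩ := isAffineOpen_iff.1 hW
  obtain ⟨g, rfl⟩ := hf.exists_basicOpen hU i
  obtain ⟨h, rfl⟩ := hf.exists_basicOpen hV j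
  obtain ⟨B, φ, hφ⟩ := _root_.exists_isAway A (g * h)
  refine isAffineOpen_iff.2 ⟨B, MSpec.map φ ≫ f, ?_⟩
  have e : hf.image (basicOpen g) ⊓ hf.image (basicOpen h) = hf.image (basicOpen (g * h)) := by
    ext x
    constructor
    · rintro ⟨⟨p, hp, rfl⟩, ⟨q, hq, e⟩⟩
      obtain rfl := hf.injective e
      exact ⟨q, q.mul_nmem hp hq, rfl⟩
    · rintro ⟨p, hp, rfl⟩
      have hp' := not_or.1 ((PrimeIdeal.mul_mem_iff p (a := g) (b := h)).not.1 hp)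
      exact ⟨⟨p, hp'.1, rfl⟩, ⟨p, hp'.2, rfl⟩⟩
  rw [e]
  exact hf.comp hφ

/-- The point of the affine open subset `U` corresponding to a prime ideal of the pointed monoid
of sections over `U`. -/
lemma existsUnique_point (hU : IsAffineOpen X U) (q : PrimeIdeal (X.presheaf.obj (op U))) :
    ∃! x : X, x ∈ U ∧ ∀ s : X.presheaf.obj (op U), s ∈ q ↔ ¬ IsUnitAt s x := by
  obtain ⟨A, f, hf⟩ := isAffineOpen_iff.1 hU
  refine ⟨f.hom.base (q.comap (MonoidWithZeroHom.ofClass hf.equiv)), ⟨hf.apply_mem _, ?_⟩, ?_⟩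
  · intro s
    obtain ⟨a, rfl⟩ := hf.equiv.surjective s
    rw [hf.isUnitAt_iff, not_not]
    rfl
  · rintro x ⟨hx, h⟩
    obtain ⟨p, rfl⟩ := hf.exists_eq hx
    refine congrArg f.hom.base (PrimeIdeal.ext (Set.ext fun a => ?_))
    refine Iff.trans ?_ (h (hf.equiv a)).symm
    rw [hf.isUnitAt_iff, not_not]
    exact Iff.rfl

/-- The continuous map `MSpec Γ(U) → X` with image the affine open subset `U`, sending a prime
ideal `q` to the point of `U` at which precisely the sections in `q` are not invertible. -/
noncomputable def fromMSpec (hU : IsAffineOpen X U) :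
    C(PrimeIdeal (X.presheaf.obj (op U)), X) where
  toFun q := (existsUnique_point hU q).choose
  continuous_toFun := by
    obtain ⟨A, f, hf⟩ := isAffineOpen_iff.1 hU
    have : (fun q => (existsUnique_point hU q).choose) =
        fun q => f.hom.base (q.comap (MonoidWithZeroHom.ofClass hf.equiv)) := by
      funext q
      refine ((existsUnique_point hU q).choose_spec.2 _ ⟨hf.apply_mem _, ?_⟩).symm
      intro s
      obtain ⟨a, rfl⟩ := hf.equiv.surjective s
      rw [hf.isUnitAt_iff, not_not]
      rfl
    rw [this]
    exact f.hom.base.hom.continuous.comp (continuous_comap _)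

lemma fromMSpec_mem (hU : IsAffineOpen X U) (q : PrimeIdeal (X.presheaf.obj (op U))) :
    fromMSpec hU q ∈ U := (existsUnique_point hU q).choose_spec.1.1

lemma mem_iff_fromMSpec (hU : IsAffineOpen X U) (q : PrimeIdeal (X.presheaf.obj (op U)))
    (s : X.presheaf.obj (op U)) : s ∈ q ↔ ¬ IsUnitAt s (fromMSpec hU q) :=
  (existsUnique_point hU q).choose_spec.1.2 s

lemma fromMSpec_comap (hU : IsAffineOpen X U) (hW : IsAffineOpen X W) (i : W ≤ U)
    (q : PrimeIdeal (X.presheaf.obj (op W))) :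
    fromMSpec hU (q.comap (res i)) = fromMSpec hW q := by
  refine (existsUnique_point hU (q.comap (res i))).unique
    ⟨fromMSpec_mem _ _, mem_iff_fromMSpec _ _⟩ ⟨i (fromMSpec_mem _ _), fun s => ?_⟩
  rw [mem_comap, mem_iff_fromMSpec hW]
  refine not_congr ⟨?_, ?_⟩
  · rintro ⟨V, j, hx, h⟩
    exact ⟨V, j.trans i, hx, by rwa [res_res] at h⟩
  · rintro ⟨V, j, hx, h⟩
    refine ⟨V ⊓ W, inf_le_right, ⟨hx, fromMSpec_mem _ _⟩, ?_⟩
    rw [res_res, ← res_res j inf_le_left]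
    exact h.map _

end MonoidalSpace

namespace PMon

variable {A B : PMon.{u}}

/-- The pointed monoid `A / c`. -/
instance conQuotient (c : Con A) : CommMonoidWithZero c.Quotient where
  zero := ((0 : A) : c.Quotient)
  zero_mul x := by
    induction x using Con.induction_on with
    | H a => exact congrArg ((↑) : A → c.Quotient) (zero_mul a)
  mul_zero x := by
    induction x using Con.induction_on with
    | H a => exact congrArg ((↑) : A → c.Quotient) (mul_zero a)

/-- A pointed monoid is a domain if it is isomorphic to a pointed submonoid of the multiplicative
monoid of a field. -/
def IsFieldSubmonoid (A : Type u) [CommMonoidWithZero A] : Prop :=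
  ∃ (K : Type u) (_ : Field K) (f : A →*₀ K), Function.Injective f

/-- The congruence space of `A`: the set of prime congruences, that is, of congruences `c` on `A`
such that `A / c` is integral. -/
def Cong (A : PMon.{u}) : Type u :=
  {c : Con A // Nontrivial c.Quotient ∧ IsCancelMulZero c.Quotient}

/-- The topology generated by the sets `U_{a,b}` of prime congruences not containing `(a, b)`. -/
instance : TopologicalSpace (Cong A) :=
  TopologicalSpace.generateFrom (Set.range fun ab : A × A => {c : Cong A | ¬ c.1 ab.1 ab.2})

/-- The strong congruence space of `A`: the subspace of `Cong A` of the congruences `c` such that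
`A / c` is a domain. -/
def SCong (A : PMon.{u}) : Type u := {c : Cong A // IsFieldSubmonoid c.1.Quotient}

instance : TopologicalSpace (SCong A) := instTopologicalSpaceSubtype

/-- The congruence kernel of a morphism to a field is determined by a morphism to a field in the
universe of the source. -/
lemma exists_field {K : Type v} [Field K] (g : A →*₀ K) :
    ∃ (K' : Type u) (_ : Field K') (g' : A →*₀ K'), ∀ a b, g' a = g' b ↔ g a = g b := by
  let φ : MonoidAlgebra ℤ A →+* K :=
    MonoidAlgebra.liftNCRingHom (Int.castRingHom K) (g : A →* K) fun _ _ => mul_comm _ _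
  have hφ : ∀ a : A, φ (MonoidAlgebra.single a 1) = g a := by
    intro a
    exact (MonoidAlgebra.liftNC_single _ _ _ _).trans (by simp)
  have := RingHom.ker_isPrime φ
  let I := RingHom.ker φ
  refine ⟨FractionRing (MonoidAlgebra ℤ A ⧸ I), inferInstance,
    { toFun := fun a => algebraMap (MonoidAlgebra ℤ A ⧸ I) _
        (Ideal.Quotient.mk I (MonoidAlgebra.single a 1))
      map_zero' := ?_
      map_one' := ?_
      map_mul' := ?_ }, ?_⟩
  · rw [Ideal.Quotient.eq_zero_iff_mem.2, map_zero]
    rw [RingHom.mem_ker, hφ, map_zero]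
  · rw [← MonoidAlgebra.one_def, map_one, map_one]
  · intro a b
    rw [← map_mul, ← map_mul, MonoidAlgebra.single_mul_single, one_mul]
  · intro a b
    refine (IsFractionRing.injective (MonoidAlgebra ℤ A ⧸ I)
      (FractionRing (MonoidAlgebra ℤ A ⧸ I))).eq_iff.trans ?_
    refine Ideal.Quotient.eq.trans ?_
    rw [RingHom.mem_ker, map_sub, sub_eq_zero, hφ, hφ]

/-- The congruence kernel of a morphism to the multiplicative monoid of a field is strong. -/
def SCong.mk (c : Con A)
    (h : ∃ (K : Type v) (_ : Field K) (g : A →*₀ K), ∀ a b, c a b ↔ g a = g b) : SCong A :=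
  have H : IsFieldSubmonoid c.Quotient := by
    obtain ⟨K, _, g, hg⟩ := h
    obtain ⟨K', _, g', hg'⟩ := exists_field g
    have hc : c ≤ Con.ker (g' : A →* K') := fun a b h => (hg' a b).2 ((hg a b).1 h)
    refine ⟨K', inferInstance,
      { c.lift (g' : A →* K') hc with map_zero' := map_zero g' }, ?_⟩
    intro x y
    induction x, y using Con.induction_on₂ with
    | H a b => exact fun h => (Con.eq c).2 ((hg a b).2 ((hg' a b).1 h))
  ⟨⟨c, by
    obtain ⟨K', _, f, hf⟩ := H
    exact ⟨⟨0, 1, fun h => zero_ne_one ((map_zero f).symm.trans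
      ((congrArg f h).trans (map_one f)))⟩, hf.isCancelMulZero f (map_zero f) (map_mul f)⟩⟩, H⟩

lemma SCong.exists_field (c : SCong A) :
    ∃ (K : Type u) (_ : Field K) (g : A →*₀ K), ∀ a b, c.1.1 a b ↔ g a = g b := by
  obtain ⟨K, _, f, hf⟩ := c.2
  refine ⟨K, inferInstance, { (f : c.1.1.Quotient →* K).comp c.1.1.mk' with
    map_zero' := map_zero f }, fun a b => ?_⟩
  exact (Con.eq _).symm.trans hf.eq_iff.symm

@[ext] lemma SCong.ext {c d : SCong A} (h : ∀ a b, c.1.1 a b ↔ d.1.1 a b) : c = d :=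
  Subtype.ext (Subtype.ext (Con.ext h))

lemma SCong.isOpen (a b : A) : IsOpen {c : SCong A | ¬ c.1.1 a b} :=
  (TopologicalSpace.isOpen_generateFrom_of_mem ⟨(a, b), rfl⟩ :
    IsOpen {c : Cong A | ¬ c.1 a b}).preimage continuous_subtype_val

lemma SCong.continuous_iff {T : Type v} [TopologicalSpace T] {f : T → SCong A} :
    Continuous f ↔ ∀ a b, IsOpen {t | ¬ (f t).1.1 a b} := by
  refine ⟨fun hf a b => (SCong.isOpen a b).preimage hf, fun h => ?_⟩
  refine continuous_induced_rng.2 (continuous_generateFrom_iff.2 ?_)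
  rintro _ ⟨⟨a, b⟩, rfl⟩
  exact h a b

/-- The pullback of strong prime congruences along a morphism. -/
def SCong.comap (f : A →*₀ B) : C(SCong B, SCong A) where
  toFun c := SCong.mk (c.1.1.comap f (map_mul f)) <| by
    obtain ⟨K, _, g, hg⟩ := c.exists_field
    exact ⟨K, inferInstance, g.comp f, fun a b => hg (f a) (f b)⟩
  continuous_toFun := SCong.continuous_iff.2 fun a b => SCong.isOpen (f a) (f b)

lemma SCong.comap_apply (f : A →*₀ B) (c : SCong B) (a b : A) :
    (SCong.comap f c).1.1 a b ↔ c.1.1 (f a) (f b) := Iff.rfl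

/-- The null ideal of a strong prime congruence. -/
def SCong.nullIdeal : C(SCong A, PrimeIdeal A) where
  toFun c :=
    { carrier := {a | c.1.1 a 0}
      zero_mem := c.1.1.refl 0
      mul_mem := fun a x hx => by
        have := c.1.1.mul (c.1.1.refl a) hx
        rwa [mul_zero] at this
      one_notMem := fun h => by
        obtain ⟨K, _, g, hg⟩ := c.exists_field
        have := (hg 1 0).1 h
        rw [map_one, map_zero] at this
        exact one_ne_zero this
      mem_or_mem := fun {a b} h => by
        obtain ⟨K, _, g, hg⟩ := c.exists_field
        have := (hg (a * b) 0).1 h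
        rw [map_mul, map_zero, mul_eq_zero] at this
        exact this.imp (fun h => (hg a 0).2 (h.trans (map_zero g).symm))
          (fun h => (hg b 0).2 (h.trans (map_zero g).symm)) }
  continuous_toFun := continuous_generateFrom_iff.2 <| by
    rintro _ ⟨h, rfl⟩
    exact SCong.isOpen h 0

/-- A morphism from a pointed monoid `A` to the multiplicative monoid of a ring `S` induces the map
`Spec S → SCong A` sending a prime ideal `P` to the congruence kernel of `A → S → S / P`. -/
def SCong.ofSpec {S : Type v} [CommRing S] (φ : A →*₀ S) : C(PrimeSpectrum S, SCong A) where
  toFun P := SCong.mk (Con.ker (((Ideal.Quotient.mk P.asIdeal : S →* S ⧸ P.asIdeal)).comp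
      (φ : A →* S))) <| by
    refine ⟨FractionRing (S ⧸ P.asIdeal), inferInstance,
      ((algebraMap (S ⧸ P.asIdeal) (FractionRing (S ⧸ P.asIdeal))).toMonoidWithZeroHom.comp
        (Ideal.Quotient.mk P.asIdeal).toMonoidWithZeroHom).comp φ, fun a b => ?_⟩
    exact (IsFractionRing.injective (S ⧸ P.asIdeal) (FractionRing (S ⧸ P.asIdeal))).eq_iff.symm
  continuous_toFun := SCong.continuous_iff.2 fun a b => by
    have : {P : PrimeSpectrum S | ¬ Ideal.Quotient.mk P.asIdeal (φ a) =
        Ideal.Quotient.mk P.asIdeal (φ b)} = PrimeSpectrum.basicOpen (φ a - φ b) := by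
      ext P
      exact (Ideal.Quotient.eq).not
    exact this ▸ (PrimeSpectrum.basicOpen (φ a - φ b)).isOpen

/-- A morphism from a pointed monoid `A` to the multiplicative monoid of a ring `S` induces the map
`Spec S → MSpec A` sending a prime ideal to its preimage. -/
def specToMSpec {S : Type v} [CommRing S] (φ : A →*₀ S) : C(PrimeSpectrum S, PrimeIdeal A) where
  toFun P :=
    { carrier := {a | φ a ∈ P.asIdeal}
      zero_mem := by
        show φ 0 ∈ P.asIdeal
        rw [map_zero]
        exact P.asIdeal.zero_mem
      mul_mem := fun a x hx => by
        show φ (a * x) ∈ P.asIdeal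
        rw [map_mul]
        exact P.asIdeal.mul_mem_left _ hx
      one_notMem := fun h => P.2.one_notMem (map_one φ ▸ h)
      mem_or_mem := fun {a b} h => P.2.mem_or_mem (map_mul φ a b ▸ h) }
  continuous_toFun := continuous_generateFrom_iff.2 <| by
    rintro _ ⟨h, rfl⟩
    exact (PrimeSpectrum.basicOpen (φ h)).isOpen

end PMon

/-- The ring `A_R`: the quotient of the monoid algebra `R[A]` by the ideal generated by the zero
of `A`. -/
def BaseRing (R : Type v) [CommRing R] (A : PMon.{u}) : Type (max u v) :=
  MonoidAlgebra R A ⧸ Ideal.span {(MonoidAlgebra.single (0 : A) (1 : R) : MonoidAlgebra R A)}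

namespace BaseRing

variable (R : Type v) [CommRing R] {A B : PMon.{u}}

noncomputable instance : CommRing (BaseRing R A) :=
  inferInstanceAs (CommRing (MonoidAlgebra R A ⧸
    Ideal.span {(MonoidAlgebra.single (0 : A) (1 : R) : MonoidAlgebra R A)}))

variable (A) in
/-- The quotient map `R[A] → A_R`. -/
noncomputable def mk : MonoidAlgebra R A →+* BaseRing R A := Ideal.Quotient.mk _

lemma mk_surjective : Function.Surjective (mk R A) := Ideal.Quotient.mk_surjective

variable (A) in
/-- The canonical morphism `A → A_R`, sending `a` to the class of `1 a`. -/
noncomputable def of : A →*₀ BaseRing R A where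
  toFun a := mk R A (MonoidAlgebra.single a 1)
  map_zero' := Ideal.Quotient.eq_zero_iff_mem.2 (Ideal.subset_span rfl)
  map_one' := map_one (mk R A)
  map_mul' a b := by
    rw [← map_mul, MonoidAlgebra.single_mul_single, one_mul]

variable (A) in
/-- The structure morphism `R → A_R`. -/
noncomputable def coeff : R →+* BaseRing R A :=
  (mk R A).comp MonoidAlgebra.singleOneRingHom

lemma mk_single (a : A) (r : R) : mk R A (MonoidAlgebra.single a r) = coeff R A r * of R A a := by
  refine Eq.trans ?_ (map_mul (mk R A) (MonoidAlgebra.single 1 r) (MonoidAlgebra.single a 1))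
  rw [MonoidAlgebra.single_mul_single, one_mul, mul_one]

lemma induction {P : BaseRing R A → Prop} (h : ∀ r a, P (coeff R A r * of R A a))
    (hadd : ∀ x y, P x → P y → P (x + y)) (x : BaseRing R A) : P x := by
  obtain ⟨x, rfl⟩ := mk_surjective R x
  induction x using MonoidAlgebra.induction_linear with
  | zero => exact (by rw [map_zero, zero_mul, map_zero] : coeff R A 0 * of R A 0 = mk R A 0) ▸ h 0 0
  | add x y hx hy => exact map_add (mk R A) x y ▸ hadd _ _ hx hy
  | single a r => exact mk_single R a r ▸ h r a

variable {R} {S : Type*} [CommRing S]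

/-- The universal property of `A_R`. -/
noncomputable def lift (r : R →+* S) (g : A →*₀ S) : BaseRing R A →+* S :=
  Ideal.Quotient.lift _ (MonoidAlgebra.liftNCRingHom r (g : A →* S) fun _ _ => mul_comm _ _) <| by
    intro x hx
    refine (Ideal.span_le (I := RingHom.ker _)).2 ?_ hx
    rintro _ rfl
    refine (MonoidAlgebra.liftNCRingHom_single _ _ _ _ _).trans ?_
    simp

lemma lift_of (r : R →+* S) (g : A →*₀ S) (a : A) : lift r g (of R A a) = g a := by
  refine (MonoidAlgebra.liftNCRingHom_single r (g : A →* S) (fun _ _ => mul_comm _ _) a 1).trans ?_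
  simp

lemma lift_coeff (r : R →+* S) (g : A →*₀ S) (x : R) : lift r g (coeff R A x) = r x := by
  refine (MonoidAlgebra.liftNCRingHom_single r (g : A →* S) (fun _ _ => mul_comm _ _) 1 x).trans ?_
  simp

lemma hom_ext {φ ψ : BaseRing R A →+* S} (h : ∀ r, φ (coeff R A r) = ψ (coeff R A r))
    (h' : ∀ a, φ (of R A a) = ψ (of R A a)) : φ = ψ := by
  ext x
  induction x using BaseRing.induction with
  | h r a => rw [map_mul, map_mul, h, h']
  | hadd x y hx hy => rw [map_add, map_add, hx, hy]

variable (R)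

/-- The ring homomorphism `A_R → B_R` induced by a morphism `A → B`. -/
noncomputable def map (f : A →*₀ B) : BaseRing R A →+* BaseRing R B :=
  lift (coeff R B) ((of R B).comp f)

lemma map_of (f : A →*₀ B) (a : A) : map R f (of R A a) = of R B (f a) := lift_of _ _ _

lemma map_coeff (f : A →*₀ B) (r : R) : map R f (coeff R A r) = coeff R B r := lift_coeff _ _ _

/-- The functor `A ↦ A_R` from pointed monoids to rings. -/
noncomputable def functor : PMon.{u} ⥤ CommRingCat.{max u v} where
  obj A := CommRingCat.of (BaseRing R A)
  map f := CommRingCat.ofHom (map R (PMon.hom f))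
  map_id A := by
    ext1
    refine hom_ext (fun r => map_coeff R _ r) fun a => map_of R _ a
  map_comp f g := by
    ext1
    refine hom_ext (fun r => ?_) fun a => ?_
    · exact (map_coeff R _ r).trans (((congrArg (map R (PMon.hom g)) (map_coeff R _ r)).trans
        (map_coeff R _ r)).symm)
    · exact (map_of R _ a).trans (((congrArg (map R (PMon.hom g)) (map_of R _ a)).trans
        (map_of R _ _)).symm)

lemma exists_lift {L : Type*} [CommMonoidWithZero L] {h : A} {f : A →*₀ B} (hf : IsAway h f)
    (g : A →*₀ L) (hg : IsUnit (g h)) : ∃ g' : B →*₀ L, ∀ a, g' (f a) = g a := by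
  obtain ⟨u, hu⟩ := hg.exists_right_inv
  have hu' : ∀ n : ℕ, g h ^ n * u ^ n = 1 := fun n => by rw [← mul_pow, hu, one_pow]
  choose n a e using hf.surj
  have key : ∀ {z : B} {m : ℕ} {b : A}, z * f h ^ m = f b → g (a z) * u ^ n z = g b * u ^ m := by
    intro z m b hb
    have : f (h ^ m * a z) = f (h ^ n z * b) := by
      simp only [map_mul, map_pow, ← hb, ← e]
      ac_rfl
    obtain ⟨k, hk⟩ := hf.eq this
    have h1 : g h ^ k * (g h ^ m * g (a z)) = g h ^ k * (g h ^ n z * g b) := by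
      simpa only [map_mul, map_pow] using congrArg g hk
    have h2 : g h ^ m * g (a z) = g h ^ n z * g b := (hg.pow k).mul_left_cancel h1
    calc g (a z) * u ^ n z = (g h ^ m * u ^ m) * (g (a z) * u ^ n z) := by rw [hu', one_mul]
      _ = (g h ^ m * g (a z)) * (u ^ m * u ^ n z) := by ac_rfl
      _ = (g h ^ n z * g b) * (u ^ m * u ^ n z) := by rw [h2]
      _ = (g h ^ n z * u ^ n z) * (g b * u ^ m) := by ac_rfl
      _ = _ := by rw [hu', one_mul]
  have kf : ∀ b, g (a (f b)) * u ^ n (f b) = g b := fun b => by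
    rw [key (z := f b) (m := 0) (b := b) (by rw [pow_zero, mul_one]), pow_zero, mul_one]
  refine ⟨{ toFun := fun z => g (a z) * u ^ n z
            map_zero' := ?_
            map_one' := ?_
            map_mul' := fun z w => ?_ }, kf⟩
  · rw [← map_zero f, kf, map_zero]
  · rw [← map_one f, kf, map_one]
  · rw [key (z := z * w) (m := n z + n w) (b := a z * a w), map_mul, pow_add]
    · ac_rfl
    · rw [map_mul, ← e, ← e, pow_add]
      ac_rfl

lemma isLocalization {h : A} {f : A →*₀ B} (hf : IsAway h f)
    [Algebra (BaseRing R A) (BaseRing R B)]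
    (halg : algebraMap (BaseRing R A) (BaseRing R B) = map R f) :
    IsLocalization.Away (of R A h) (BaseRing R B) := by
  have hu : IsUnit (of R B (f h)) := hf.isUnit.map _
  refine IsLocalization.Away.mk _ ?_ ?_ ?_
  · rw [halg, map_of]
    exact hu
  · intro z
    rw [halg, map_of]
    induction z using BaseRing.induction with
    | h r b =>
      obtain ⟨n, a, e⟩ := hf.surj b
      refine ⟨n, coeff R A r * of R A a, ?_⟩
      rw [map_mul, map_of, map_coeff, ← e, map_mul, map_pow, mul_assoc]
    | hadd x y hx hy =>
      obtain ⟨n, a, ha⟩ := hx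
      obtain ⟨m, b, hb⟩ := hy
      refine ⟨n + m, a * of R A h ^ m + b * of R A h ^ n, ?_⟩
      rw [map_add, map_mul, map_mul, map_pow, map_pow, map_of, ← ha, ← hb]
      ring
  · intro x y hxy
    rw [halg] at hxy
    let L := Localization.Away (of R A h)
    obtain ⟨g, hg⟩ := exists_lift hf ((algebraMap (BaseRing R A) L).toMonoidWithZeroHom.comp (of R A))
      (IsLocalization.Away.algebraMap_isUnit (of R A h))
    let ψ : BaseRing R B →+* L := lift ((algebraMap (BaseRing R A) L).comp (coeff R A)) g
    have hψ : ψ.comp (map R f) = algebraMap (BaseRing R A) L := by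
      refine hom_ext (fun r => ?_) fun a => ?_
      · rw [RingHom.comp_apply, map_coeff, lift_coeff]
        rfl
      · rw [RingHom.comp_apply, map_of, lift_of, hg]
        rfl
    have : algebraMap (BaseRing R A) L x = algebraMap (BaseRing R A) L y := by
      rw [← hψ, RingHom.comp_apply, RingHom.comp_apply, hxy]
    exact IsLocalization.Away.exists_of_eq (of R A h) this

/-- The morphism `Spec B_R → Spec A_R` induced by a localization `A → B` is an open immersion. -/
lemma isOpenImmersion {A B : PMon.{u}} {h : A} {f : A ⟶ B} (hf : IsAway h (PMon.hom f)) :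
    IsOpenImmersion (Spec.map ((functor R).map f)) := by
  algebraize [map R (PMon.hom f)]
  have := isLocalization R hf rfl
  exact IsOpenImmersion.of_isLocalization (of R A h)

end BaseRing

/-- A monoid scheme: a space with a sheaf of pointed monoids that is covered by affine open
subsets. -/
structure MonoidScheme : Type (u + 1) where
  space : SheafedSpace PMon.{u}
  exists_affine : ∀ x : space, ∃ U : Opens space, MonoidalSpace.IsAffineOpen space U ∧ x ∈ U

namespace MonoidScheme

open MonoidalSpace

variable (X : MonoidScheme.{u}) (R : Type v) [CommRing R]

/-- The ordered set of affine open subsets of `X`, seen as a category. -/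
def AffineOpens : Type u := {U : Opens X.space // IsAffineOpen X.space U}

instance : PartialOrder X.AffineOpens := Subtype.partialOrder _

variable {X}

/-- The pointed monoid of sections over an affine open subset. -/
abbrev AffineOpens.sections (U : X.AffineOpens) : PMon.{u} := X.space.presheaf.obj (op U.1)

/-- Restriction of sections between affine open subsets. -/
abbrev AffineOpens.res {U V : X.AffineOpens} (i : U ≤ V) : V.sections →*₀ U.sections :=
  MonoidalSpace.res (X := X.space) (U := V.1) (V := U.1) i

variable (X)

/-- The functor sending an affine open subset to its pointed monoid of sections. -/
def sectionsFunctor : X.AffineOpensᵒᵖ ⥤ PMon.{u} where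
  obj U := U.unop.sections
  map f := PMon.ofHom (AffineOpens.res f.unop.le)
  map_id U := X.space.presheaf.map_id _
  map_comp {U V W} f g := X.space.presheaf.map_comp
    (homOfLE (show V.unop.1 ≤ U.unop.1 from f.unop.le)).op
    (homOfLE (show W.unop.1 ≤ V.unop.1 from g.unop.le)).op

/-- The diagram of topological spaces `U ↦ SCong Γ(U)` indexed by the affine open subsets. -/
def scongDiagram : X.AffineOpens ⥤ TopCat.{u} where
  obj U := TopCat.of (PMon.SCong U.sections)
  map f := TopCat.ofHom (PMon.SCong.comap (AffineOpens.res f.le))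
  map_id U := by
    refine ConcreteCategory.hom_ext _ _ fun c => PMon.SCong.ext fun a b => ?_
    have h : ∀ a, AffineOpens.res le_rfl a = a := fun a =>
      ConcreteCategory.congr_hom (X.space.presheaf.map_id (op U.1)) a
    exact (PMon.SCong.comap_apply _ _ _ _).trans (by rw [h, h]; rfl)
  map_comp f g := by
    refine ConcreteCategory.hom_ext _ _ fun c => PMon.SCong.ext fun a b => ?_
    have h : ∀ a, AffineOpens.res f.le (AffineOpens.res g.le a) = AffineOpens.res (f ≫ g).le a :=
      fun a => MonoidalSpace.res_res _ _ a
    exact (PMon.SCong.comap_apply _ _ _ _).trans (by rw [← h, ← h]; rfl)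

/-- The strong congruence space of a monoid scheme. -/
noncomputable def SCong : TopCat.{u} := colimit X.scongDiagram

variable {X} in
/-- The canonical map `SCong Γ(U) → SCong X` for an affine open subset `U`. -/
noncomputable def ιSCong (U : X.AffineOpens) : C(PMon.SCong U.sections, X.SCong) :=
  (colimit.ι X.scongDiagram U).hom

variable {X} in
/-- The continuous map `MSpec Γ(U) → X` with image the affine open subset `U`. -/
noncomputable def ιMSpec (U : X.AffineOpens) : C(PrimeIdeal U.sections, X.space) :=
  fromMSpec U.2

/-- The projection `SCong X → X`, sending a strong prime congruence on `Γ(U)` to its null ideal. -/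
noncomputable def πSCong : C(X.SCong, X.space) :=
  (colimit.desc X.scongDiagram
    { pt := X.space.carrier
      ι :=
        { app := fun U => TopCat.ofHom ((ιMSpec U).comp PMon.SCong.nullIdeal)
          naturality := fun U V f => by
            ext c
            refine Eq.trans ?_ (fromMSpec_comap V.2 U.2 f.le _)
            refine congrArg (fromMSpec V.2) (PrimeIdeal.ext (Set.ext fun a => ?_))
            exact (PMon.SCong.comap_apply _ _ _ _).trans (by rw [map_zero]; rfl) } }).hom

lemma πSCong_ι (U : X.AffineOpens) (c : PMon.SCong U.sections) :
    X.πSCong (ιSCong U c) = ιMSpec U (PMon.SCong.nullIdeal c) :=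
  ConcreteCategory.congr_hom (colimit.ι_desc (F := X.scongDiagram) _ U) c

/-- The diagram of schemes `U ↦ U_R = Spec Γ(U)_R` indexed by the affine open subsets. -/
noncomputable def baseExtDiagram : X.AffineOpens ⥤ Scheme.{max u v} :=
  X.sectionsFunctor.rightOp ⋙ (BaseRing.functor R).op ⋙ Scheme.Spec

/-- The affine scheme `U_R`. -/
noncomputable abbrev AffineOpens.baseExt {X : MonoidScheme.{u}} (U : X.AffineOpens) :
    Scheme.{max u v} := Spec (CommRingCat.of (BaseRing R U.sections))

instance {U V : X.AffineOpens} (f : U ⟶ V) : IsOpenImmersion ((X.baseExtDiagram R).map f) := by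
  obtain ⟨h, hh⟩ := exists_isAway V.2 U.2 f.le
  have := BaseRing.isOpenImmersion R (f := X.sectionsFunctor.map f.op) hh
  exact this

variable {X} in
/-- The map `U_R → X`, sending a prime ideal of `Γ(U)_R` to the point of `U` corresponding to its
preimage in `Γ(U)`. -/
noncomputable def affineProj (U : X.AffineOpens) :
    C(PrimeSpectrum (BaseRing R U.sections), X.space) :=
  (ιMSpec U).comp (PMon.specToMSpec (BaseRing.of R U.sections))

lemma affineProj_map {U V : X.AffineOpens} (f : U ⟶ V) (y : (X.baseExtDiagram R).obj U) :
    affineProj R V ((X.baseExtDiagram R).map f y) = affineProj R U y := by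
  refine Eq.trans ?_ (fromMSpec_comap V.2 U.2 f.le _)
  refine congrArg (fromMSpec V.2) (PrimeIdeal.ext (Set.ext fun a => ?_))
  exact iff_of_eq (congrArg (· ∈ y.asIdeal) (BaseRing.map_of R (AffineOpens.res f.le) a))

lemma mem_range_map_iff {U V : X.AffineOpens} (f : U ⟶ V) (y : (X.baseExtDiagram R).obj V) :
    y ∈ Set.range ((X.baseExtDiagram R).map f) ↔ affineProj R V y ∈ U.1 := by
  constructor
  · rintro ⟨z, rfl⟩
    rw [affineProj_map]
    exact fromMSpec_mem U.2 _
  · intro hy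
    obtain ⟨h, hh⟩ := exists_isAway V.2 U.2 f.le
    have hm : h ∉ PMon.specToMSpec (BaseRing.of R V.sections) y := by
      rw [mem_iff_fromMSpec V.2, not_not]
      exact ⟨U.1, f.le, hy, hh.isUnit⟩
    let _ := (BaseRing.map R (AffineOpens.res f.le)).toAlgebra
    have := BaseRing.isLocalization R hh rfl
    have hr := PrimeSpectrum.localization_away_comap_range (BaseRing R U.sections)
      (BaseRing.of R V.sections h)
    have : (y : PrimeSpectrum (BaseRing R V.sections)) ∈ Set.range (PrimeSpectrum.comap
        (algebraMap (BaseRing R V.sections) (BaseRing R U.sections))) := by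
      rw [hr]
      exact hm
    exact this

instance : (X.baseExtDiagram R ⋙ Scheme.forget).IsLocallyDirected where
  cond {U V W} f g x y e := by
    have e' : (X.baseExtDiagram R).map f x = (X.baseExtDiagram R).map g y := e
    let Z : X.AffineOpens := ⟨U.1 ⊓ V.1, isAffineOpen_inf U.2 V.2 W.2 f.le g.le⟩
    let i : Z ⟶ U := homOfLE (inf_le_left : U.1 ⊓ V.1 ≤ U.1)
    let j : Z ⟶ V := homOfLE (inf_le_right : U.1 ⊓ V.1 ≤ V.1)
    have hx : affineProj R U x ∈ Z.1 := by
      refine ⟨fromMSpec_mem U.2 _, ?_⟩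
      rw [← affineProj_map X R f x, e', affineProj_map]
      exact fromMSpec_mem V.2 _
    obtain ⟨z, rfl⟩ := (mem_range_map_iff X R i x).2 hx
    refine ⟨Z, i, j, z, rfl, ?_⟩
    refine ((X.baseExtDiagram R).map g).isOpenEmbedding.injective ?_
    refine Eq.trans ?_ e'
    have h1 : (X.baseExtDiagram R).map g ((X.baseExtDiagram R).map j z) =
      (X.baseExtDiagram R).map (j ≫ g) z := by
        rw [Functor.map_comp, Scheme.Hom.comp_apply]
    have h2 : (X.baseExtDiagram R).map f ((X.baseExtDiagram R).map i z) =
      (X.baseExtDiagram R).map (i ≫ f) z := by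
        rw [Functor.map_comp, Scheme.Hom.comp_apply]
    exact h1.trans h2.symm

instance : Quiver.IsThin X.AffineOpens := fun _ _ => ⟨fun _ _ => Subsingleton.elim _ _⟩

/-- The base extension `X_R` of a monoid scheme `X` to a ring `R`. -/
noncomputable def baseExt : Scheme.{max u v} := colimit (X.baseExtDiagram R)

variable {X} in
/-- The open immersion `U_R → X_R` for an affine open subset `U`. -/
noncomputable def ιBaseExt (U : X.AffineOpens) : U.baseExt R ⟶ X.baseExt R :=
  colimit.ι (X.baseExtDiagram R) U

lemma exists_ιBaseExt_eq (x : X.baseExt R) :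
    ∃ (U : X.AffineOpens) (y : U.baseExt R), ιBaseExt R U y = x :=
  Scheme.IsLocallyDirected.ι_jointly_surjective (X.baseExtDiagram R) x

instance (U : X.AffineOpens) : IsOpenImmersion (ιBaseExt R U) :=
  inferInstanceAs (IsOpenImmersion (colimit.ι (X.baseExtDiagram R) U))

section Glue

variable {T : Type*} [TopologicalSpace T] (φ : ∀ U : X.AffineOpens, C(U.baseExt R, T))

lemma glue_wellDefined
    (hφ : ∀ (U V : X.AffineOpens) (f : U ⟶ V) (y : U.baseExt R),
      φ V ((X.baseExtDiagram R).map f y) = φ U y)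
    {U V : X.AffineOpens} {y : U.baseExt R} {z : V.baseExt R}
    (e : ιBaseExt R U y = ιBaseExt R V z) : φ U y = φ V z := by
  obtain ⟨W, f, g, w, rfl, rfl⟩ :=
    (Scheme.IsLocallyDirected.ι_eq_ι_iff (X.baseExtDiagram R)).1 e
  exact (hφ W U f w).trans (hφ W V g w).symm

/-- A compatible family of continuous maps on the affine pieces `U_R` glues to a continuous map. -/
noncomputable def glueBaseExt
    (hφ : ∀ (U V : X.AffineOpens) (f : U ⟶ V) (y : U.baseExt R),
      φ V ((X.baseExtDiagram R).map f y) = φ U y) : C(X.baseExt R, T) where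
  toFun x := φ _ (exists_ιBaseExt_eq X R x).choose_spec.choose
  continuous_toFun := by
    refine continuous_def.2 fun O hO => isOpen_iff_forall_mem_open.2 fun x hx => ?_
    obtain ⟨U, y, rfl⟩ := exists_ιBaseExt_eq X R x
    refine ⟨ιBaseExt R U '' (φ U ⁻¹' O), ?_,
      (ιBaseExt R U).isOpenEmbedding.isOpenMap _ (hO.preimage (φ U).continuous), y, ?_, rfl⟩
    · rintro _ ⟨z, hz, rfl⟩
      have := glue_wellDefined X R φ hφ
        (exists_ιBaseExt_eq X R (ιBaseExt R U z)).choose_spec.choose_spec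
      exact Set.mem_of_eq_of_mem (s := O) this hz
    · have := glue_wellDefined X R φ hφ
        (exists_ιBaseExt_eq X R (ιBaseExt R U y)).choose_spec.choose_spec
      exact Set.mem_of_eq_of_mem (s := O) this.symm hx

lemma glueBaseExt_ι
    (hφ : ∀ (U V : X.AffineOpens) (f : U ⟶ V) (y : U.baseExt R),
      φ V ((X.baseExtDiagram R).map f y) = φ U y) (U : X.AffineOpens) (y : U.baseExt R) :
    glueBaseExt X R φ hφ (ιBaseExt R U y) = φ U y :=
  glue_wellDefined X R φ hφ (exists_ιBaseExt_eq X R (ιBaseExt R U y)).choose_spec.choose_spec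

end Glue

/-- The continuous map underlying the projection `p_R : X_R → X`. For every affine open subset `U`
of `X` it sends a prime ideal of `Γ(U)_R` to the point of `U` corresponding to its preimage
in `Γ(U)`. -/
noncomputable def proj : C(X.baseExt R, X.space) :=
  glueBaseExt X R (affineProj R) fun _ _ f y => affineProj_map X R f y

lemma proj_ι (U : X.AffineOpens) (y : U.baseExt R) :
    X.proj R (ιBaseExt R U y) = affineProj R U y := glueBaseExt_ι X R _ _ U y

/-- The map `γ : X_R → SCong X` is characterized by the following property: for every affine open
subset `U` of `X`, it restricts to the map `U_R → SCong Γ(U)` that is induced by the canonical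
morphism `Γ(U) → Γ(U)_R`, and thus sends a prime ideal `P` to the congruence kernel of the
composition `Γ(U) → Γ(U)_R → Γ(U)_R / P`. -/
def IsGamma (γ : C(X.baseExt R, X.SCong)) : Prop :=
  ∀ (U : X.AffineOpens) (y : U.baseExt R),
    γ (ιBaseExt R U y) = ιSCong U (PMon.SCong.ofSpec (BaseRing.of R U.sections) y)

end MonoidScheme

/-! A strong prime congruence on `A` is the same as the kernel of a morphism from `A` to a field.
Two consequences carry the proof.

The first concerns localizations `A → A[h⁻¹]`. A morphism `A → K` to a field extends to `A[h⁻¹]`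
exactly when it does not kill `h`, and every relation over `A[h⁻¹]` can be cleared of denominators.
Hence `SCong A[h⁻¹] → SCong A` is an open embedding with image the congruences whose null ideal
avoids `h` (`isOpenEmbedding_comap`, `mem_range_comap_iff`). An inclusion `U ⊆ V` of affine opens is
such a localization on sections, so all transition maps of the diagram defining `SCong X` are open
embeddings, and a congruence over `V` comes from `U` as soon as the point of `X` below it lies in
`U` (`mem_range_scongDiagram_map`). Two affine opens inside a common affine open have affine
intersection. Therefore coming from a common congruence over a smaller affine open is already an
equivalence relation (`AgreeLocally.trans`), and it describes the identifications made in the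
colimit (`ιSCong_eq_iff`). Injectivity and openness of `SCong Γ(U) → SCong X` follow.

The second concerns the map `γ`. The maps `U_R → SCong Γ(U)` are natural in `U`, so they glue, and
they determine `γ` because the `U_R` cover `X_R`. The elements congruent to `0` modulo a prime are
its preimage in `Γ(U)`, which gives `π_X ∘ γ = p_R`. For `R = ℤ`, every morphism `Γ(U) → K` to a
field extends to a ring homomorphism `Γ(U)_ℤ → K`. The kernel of that homomorphism is a prime
inducing the given congruence (`ofSpec_surjective`), whence surjectivity. -/

namespace PMon.SCong

/-! ### Strong prime congruences on a localization -/

variable {A B : PMon.{u}} {h : A} {f : A →*₀ B}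

lemma not_rel_zero_of_isUnit (c : SCong A) {a : A} (ha : IsUnit a) : ¬ c.1.1 a 0 :=
  (nullIdeal c).not_mem_of_isUnit ha

/-- Clearing denominators: multiplying `z` and `w` by the common power `f h ^ (n + m)` gives
elements coming from `A`, and this power is a unit, so it can be cancelled again. Thus a congruence
on the localization is controlled by its relations between elements of `A`. -/
lemma rel_iff_of_isAway (hf : IsAway h f) (c : SCong B) {z w : B} {n m : ℕ} {a b : A}
    (ha : z * f h ^ n = f a) (hb : w * f h ^ m = f b) :
    c.1.1 z w ↔ c.1.1 (f (a * h ^ m)) (f (b * h ^ n)) := by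
  obtain ⟨K, _, g, hg⟩ := c.exists_field
  have h1 : f (a * h ^ m) = z * f h ^ (n + m) := by
    rw [map_mul, map_pow, ← ha, pow_add, mul_assoc]
  have h2 : f (b * h ^ n) = w * f h ^ (n + m) := by
    rw [map_mul, map_pow, ← hb, add_comm, pow_add, mul_assoc]
  rw [hg, hg, h1, h2, map_mul g, map_mul g]
  exact (((hf.isUnit.pow (n + m)).map g).mul_left_inj).symm

lemma comap_injective (hf : IsAway h f) : Function.Injective (comap f) := by
  intro c d e
  ext z w
  obtain ⟨n, a, ha⟩ := hf.surj z
  obtain ⟨m, b, hb⟩ := hf.surj w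
  rw [rel_iff_of_isAway hf c ha hb, rel_iff_of_isAway hf d ha hb, ← comap_apply, e, comap_apply]

/-- Write `c` as the kernel of a morphism `g` to a field. If `h` is not congruent to `0`, then `g h`
is nonzero, hence a unit, and `g` extends to the localization. The kernel of the extension pulls
back to `c`. Conversely, a unit of the localization is never congruent to `0`. -/
lemma mem_range_comap_iff (hf : IsAway h f) (c : SCong A) :
    c ∈ Set.range (comap f) ↔ ¬ c.1.1 h 0 := by
  constructor
  · rintro ⟨d, rfl⟩
    rw [comap_apply, map_zero]
    exact d.not_rel_zero_of_isUnit hf.isUnit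
  · intro hc
    obtain ⟨K, _, g, hg⟩ := c.exists_field
    have hu : IsUnit (g h) := isUnit_iff_ne_zero.2 fun h0 => hc ((hg _ _).2 (by rw [h0, map_zero]))
    obtain ⟨g', hg'⟩ := BaseRing.exists_lift hf g hu
    refine ⟨SCong.mk (Con.ker (g' : B →* K)) ⟨K, inferInstance, g', fun _ _ => Iff.rfl⟩, ?_⟩
    ext a b
    rw [hg, ← hg', ← hg']
    exact Iff.rfl

lemma isOpen_range_comap (hf : IsAway h f) : IsOpen (Set.range (comap f)) := by
  have : Set.range (comap f) = {c | ¬ c.1.1 h 0} := Set.ext (mem_range_comap_iff hf)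
  exact this ▸ SCong.isOpen h 0

/-- After clearing denominators, each generating open set of `SCong B` is the preimage of a
generating open set of `SCong A`. -/
lemma isInducing_comap (hf : IsAway h f) : Topology.IsInducing (comap f) := by
  refine ⟨le_antisymm (comap f).continuous.le_induced ?_⟩
  -- The remaining inequality of topologies says that the identity is continuous from the induced
  -- topology to the given one, which can be tested on generating open sets.
  refine continuous_id_iff_le.1 ?_
  let _ : TopologicalSpace (SCong B) := .induced (comap f) inferInstance
  refine SCong.continuous_iff.2 fun z w => ?_
  obtain ⟨n, a, ha⟩ := hf.surj z
  obtain ⟨m, b, hb⟩ := hf.surj w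
  refine isOpen_induced_iff.2 ⟨_, SCong.isOpen (a * h ^ m) (b * h ^ n), ?_⟩
  ext c
  exact (rel_iff_of_isAway hf c ha hb).symm.not

lemma isOpenEmbedding_comap (hf : IsAway h f) : Topology.IsOpenEmbedding (comap f) :=
  ⟨⟨isInducing_comap hf, comap_injective hf⟩, isOpen_range_comap hf⟩

/-! ### Congruences induced by prime ideals of rings -/

/-- Every strong prime congruence on `A` is induced by a prime ideal of `A_ℤ`. -/
lemma ofSpec_surjective (A : PMon.{u}) : Function.Surjective (ofSpec (BaseRing.of ℤ A)) := by
  intro c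
  obtain ⟨K, _, g, hg⟩ := c.exists_field
  -- The choice of `ℤ` matters here: every field `K` receives a homomorphism from `ℤ`, so `g`
  -- extends to `A_ℤ`. The kernel of the extension is prime because `K` is a field.
  let φ : BaseRing ℤ A →+* K := BaseRing.lift (Int.castRingHom K) g
  refine ⟨⟨RingHom.ker φ, RingHom.ker_isPrime φ⟩, ?_⟩
  ext a b
  rw [hg]
  refine Ideal.Quotient.eq.trans ?_
  rw [RingHom.mem_ker, map_sub, sub_eq_zero]
  exact iff_of_eq (congrArg₂ _ (BaseRing.lift_of _ _ _) (BaseRing.lift_of _ _ _))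

/-- Naturality of `ofSpec` in a commutative square: on both sides `a` and `b` are related exactly
when `r` sends `φ a - φ b` into `P`. This makes the affine pieces of `γ` compatible. -/
lemma ofSpec_comap {S T : Type*} [CommRing S] [CommRing T] (φ : A →*₀ S) (ψ : B →*₀ T)
    (r : S →+* T) (hr : ∀ a, r (φ a) = ψ (f a)) (P : PrimeSpectrum T) :
    ofSpec φ (PrimeSpectrum.comap r P) = comap f (ofSpec ψ P) := by
  ext a b
  refine Ideal.Quotient.eq.trans (Iff.trans ?_ (Ideal.Quotient.eq.symm :
    _ ↔ Ideal.Quotient.mk P.asIdeal (ψ (f a)) = Ideal.Quotient.mk P.asIdeal (ψ (f b))))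
  rw [PrimeSpectrum.comap_asIdeal, Ideal.mem_comap]
  change r (φ a - φ b) ∈ P.asIdeal ↔ _
  rw [map_sub, hr, hr]

/-- As `φ 0 = 0`, being congruent to `0` modulo `P` means lying in the preimage of `P`. This is the
affine case of `π_X ∘ γ = p_R`. -/
lemma nullIdeal_ofSpec {S : Type*} [CommRing S] (φ : A →*₀ S) (P : PrimeSpectrum S) :
    nullIdeal (ofSpec φ P) = specToMSpec φ P := by
  ext a
  refine (Ideal.Quotient.eq :
    Ideal.Quotient.mk P.asIdeal (φ a) = Ideal.Quotient.mk P.asIdeal (φ 0) ↔ _).trans ?_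
  rw [map_zero, sub_zero]
  exact Iff.rfl

end PMon.SCong

/-! ### The diagram of strong congruence spaces -/

namespace MonoidScheme

open MonoidalSpace

variable (X : MonoidScheme.{u}) (R : Type v) [CommRing R]

/-- Restriction of sections preserves `0`, so null ideals pull back to null ideals, and a prime and
its pullback mark the same point of `X`. Hence the point of `X` below a congruence does not change
along the diagram. -/
lemma ιMSpec_nullIdeal_map {U V : X.AffineOpens} (f : U ⟶ V) (c : PMon.SCong U.sections) :
    ιMSpec V (PMon.SCong.nullIdeal (X.scongDiagram.map f c)) =
      ιMSpec U (PMon.SCong.nullIdeal c) := by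
  refine Eq.trans ?_ (fromMSpec_comap V.2 U.2 f.le _)
  refine congrArg (fromMSpec V.2) (PrimeIdeal.ext (Set.ext fun a => ?_))
  exact (PMon.SCong.comap_apply _ _ _ _).trans (by rw [map_zero]; rfl)

lemma isOpenEmbedding_scongDiagram_map {U V : X.AffineOpens} (f : U ⟶ V) :
    Topology.IsOpenEmbedding (X.scongDiagram.map f) := by
  obtain ⟨h, hh⟩ := exists_isAway V.2 U.2 f.le
  exact PMon.SCong.isOpenEmbedding_comap hh

/-- The element `h` whose inversion turns the sections over `V` into those over `U` restricts to a
unit on `U`. If the point below `c` lies in `U`, then `h` is invertible near it, hence outside the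
null ideal, and the criterion `mem_range_comap_iff` applies. -/
lemma mem_range_scongDiagram_map {U V : X.AffineOpens} (f : U ⟶ V) (c : PMon.SCong V.sections)
    (hc : ιMSpec V (PMon.SCong.nullIdeal c) ∈ U.1) : ∃ d, X.scongDiagram.map f d = c := by
  obtain ⟨h, hh⟩ := exists_isAway V.2 U.2 f.le
  refine (PMon.SCong.mem_range_comap_iff hh c).2 ?_
  have := (mem_iff_fromMSpec V.2 (PMon.SCong.nullIdeal c) h).not
  refine this.2 (not_not.2 ?_)
  exact ⟨U.1, f.le, hc, hh.isUnit⟩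

lemma scongDiagram_map_map {U V W : X.AffineOpens} (f : U ⟶ V) (g : V ⟶ W)
    (c : PMon.SCong U.sections) :
    X.scongDiagram.map g (X.scongDiagram.map f c) = X.scongDiagram.map (f ≫ g) c :=
  (ConcreteCategory.congr_hom (X.scongDiagram.map_comp f g) c).symm

/-! ### Points and open sets of the colimit -/

variable {X}

/-- Strong prime congruences over `U` and `V` agree locally if they are induced by a common
strong prime congruence over an affine open subset of `U ∩ V`. -/
def AgreeLocally {U V : X.AffineOpens} (c : PMon.SCong U.sections) (d : PMon.SCong V.sections) :
    Prop :=
  ∃ (W : X.AffineOpens) (f : W ⟶ U) (g : W ⟶ V) (e : PMon.SCong W.sections),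
    X.scongDiagram.map f e = c ∧ X.scongDiagram.map g e = d

lemma AgreeLocally.of_map {U V : X.AffineOpens} (f : U ⟶ V) {c : PMon.SCong U.sections}
    {d : PMon.SCong V.sections} (h : X.scongDiagram.map f c = d) : AgreeLocally c d :=
  ⟨U, 𝟙 _, f, c, ConcreteCategory.congr_hom (X.scongDiagram.map_id U) c, h⟩

lemma AgreeLocally.refl {U : X.AffineOpens} (c : PMon.SCong U.sections) : AgreeLocally c c :=
  .of_map (𝟙 _) (ConcreteCategory.congr_hom (X.scongDiagram.map_id U) c)

lemma AgreeLocally.symm {U V : X.AffineOpens} {c : PMon.SCong U.sections}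
    {d : PMon.SCong V.sections} : AgreeLocally c d → AgreeLocally d c :=
  fun ⟨W, f, g, e, hf, hg⟩ => ⟨W, g, f, e, hg, hf⟩

/-- The witnesses `e` and `e'` induce the same congruence `d` over `V`, so they lie over the same
point of `X`, which belongs to `W ∩ W'`. This intersection is affine because both sets lie in the
affine `V`, and a congruence over it serves as common origin. -/
lemma AgreeLocally.trans {U V V' : X.AffineOpens} {c : PMon.SCong U.sections}
    {d : PMon.SCong V.sections} {d' : PMon.SCong V'.sections} :
    AgreeLocally c d → AgreeLocally d d' → AgreeLocally c d' := by
  rintro ⟨W, f, g, e, rfl, hg⟩ ⟨W', f', g', e', hf', rfl⟩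
  let Z : X.AffineOpens := ⟨W.1 ⊓ W'.1, isAffineOpen_inf W.2 W'.2 V.2 g.le f'.le⟩
  let i : Z ⟶ W := homOfLE (inf_le_left : W.1 ⊓ W'.1 ≤ W.1)
  let j : Z ⟶ W' := homOfLE (inf_le_right : W.1 ⊓ W'.1 ≤ W'.1)
  have he : ιMSpec W (PMon.SCong.nullIdeal e) ∈ Z.1 := by
    refine ⟨fromMSpec_mem W.2 _, ?_⟩
    rw [← ιMSpec_nullIdeal_map X g e, hg, ← hf', ιMSpec_nullIdeal_map]
    exact fromMSpec_mem W'.2 _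
  obtain ⟨z, rfl⟩ := X.mem_range_scongDiagram_map i e he
  refine ⟨Z, i ≫ f, j ≫ g', z, (X.scongDiagram_map_map i f z).symm, ?_⟩
  refine (X.scongDiagram_map_map j g' z).symm.trans (congrArg (X.scongDiagram.map g') ?_)
  -- The image of `z` over `W'` must be `e'`: both induce `d` over `V`, and the transition map from
  -- `W'` to `V` is injective.
  refine (X.isOpenEmbedding_scongDiagram_map f').injective ?_
  exact (X.scongDiagram_map_map j f' z).trans
    ((X.scongDiagram_map_map i g z).symm.trans (hg.trans hf'.symm))

lemma AgreeLocally.equivalence :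
    Equivalence fun c d : Σ U : X.AffineOpens, PMon.SCong U.sections => AgreeLocally c.2 d.2 :=
  ⟨fun c => .refl c.2, .symm, .trans⟩

lemma ιSCong_map {U V : X.AffineOpens} (f : U ⟶ V) (c : PMon.SCong U.sections) :
    ιSCong V (X.scongDiagram.map f c) = ιSCong U c :=
  ConcreteCategory.congr_hom (colimit.w X.scongDiagram f) c

/-- The identifications in the colimit form the equivalence relation generated by the transition
maps. `AgreeLocally` contains these generators and is itself an equivalence relation, so no longer
zigzags are needed. -/
lemma ιSCong_eq_iff {U V : X.AffineOpens} {c : PMon.SCong U.sections} {d : PMon.SCong V.sections} :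
    ιSCong U c = ιSCong V d ↔ AgreeLocally c d := by
  constructor
  · intro h
    -- The forgetful functor to sets preserves colimits, so equality may be tested in the colimit of
    -- the underlying sets.
    have h' := congrArg (preservesColimitIso (forget TopCat) X.scongDiagram).hom h
    have key : ∀ (W : X.AffineOpens) (e : PMon.SCong W.sections),
        (preservesColimitIso (forget TopCat) X.scongDiagram).hom (ιSCong W e) =
          colimit.ι (X.scongDiagram ⋙ forget TopCat) W e := fun W e =>
      ConcreteCategory.congr_hom (ι_preservesColimitIso_hom (forget TopCat) X.scongDiagram W) e
    have h'' := Types.colimit_eq (((key U c).symm.trans h').trans (key V d))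
    refine (Equivalence.eqvGen_iff (a := ⟨U, c⟩) (b := ⟨V, d⟩)
      (AgreeLocally.equivalence (X := X))).1 (h''.mono ?_)
    rintro ⟨W, e⟩ ⟨W', e'⟩ ⟨f, hf⟩
    exact .of_map f hf.symm
  · rintro ⟨W, f, g, e, rfl, rfl⟩
    exact (ιSCong_map f e).trans (ιSCong_map g e).symm

lemma exists_ιSCong_eq (x : X.SCong) :
    ∃ (U : X.AffineOpens) (c : PMon.SCong U.sections), ιSCong U c = x :=
  Concrete.colimit_exists_rep X.scongDiagram x

lemma ιSCong_injective (U : X.AffineOpens) : Function.Injective (ιSCong U) := by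
  intro c d h
  obtain ⟨W, f, g, e, hf, hg⟩ := ιSCong_eq_iff.1 h
  -- Both `f` and `g` are arrows `W ⟶ U` in an ordered set, hence equal, so `c` and `d` are the
  -- image of `e` under the same map.
  exact hf.symm.trans hg

/-- Openness in the colimit is tested on each `SCong Γ(V)`. A point there that is identified with
some `c` in `O` comes, together with `c`, from a congruence over a smaller affine `W`. The
congruences over `W` that map into `O` form an open set, whose image over `V` is the required
neighbourhood. -/
lemma isOpenMap_ιSCong (U : X.AffineOpens) : IsOpenMap (ιSCong U) := by
  intro O hO
  refine (TopCat.colimit_isOpen_iff X.scongDiagram _).2 fun V => ?_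
  refine isOpen_iff_forall_mem_open.2 ?_
  rintro d ⟨c, hc, h⟩
  obtain ⟨W, f, g, e, rfl, rfl⟩ := ιSCong_eq_iff.1 h
  refine ⟨X.scongDiagram.map g '' (X.scongDiagram.map f ⁻¹' O), ?_,
    (X.isOpenEmbedding_scongDiagram_map g).isOpenMap _
      (hO.preimage (X.isOpenEmbedding_scongDiagram_map f).continuous), e, hc, rfl⟩
  rintro _ ⟨e', he', rfl⟩
  exact ⟨_, he', (ιSCong_map f e').trans (ιSCong_map g e').symm⟩

lemma isOpenEmbedding_ιSCong (U : X.AffineOpens) : Topology.IsOpenEmbedding (ιSCong U) :=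
  .of_continuous_injective_isOpenMap (ιSCong U).continuous (ιSCong_injective U) (isOpenMap_ιSCong U)

/-! ### The map `γ` and its properties -/

variable (X)

lemma ofSpec_baseExtDiagram_map {U V : X.AffineOpens} (f : U ⟶ V) (y : U.baseExt R) :
    PMon.SCong.ofSpec (BaseRing.of R V.sections) ((X.baseExtDiagram R).map f y) =
      X.scongDiagram.map f (PMon.SCong.ofSpec (BaseRing.of R U.sections) y) :=
  PMon.SCong.ofSpec_comap (f := AffineOpens.res f.le) _ _ _
    (BaseRing.map_of R (AffineOpens.res f.le)) y

/-- The map `γ : X_R → SCong X`. -/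
noncomputable def gamma : C(X.baseExt R, X.SCong) :=
  glueBaseExt X R (fun U => (ιSCong U).comp (PMon.SCong.ofSpec (BaseRing.of R U.sections)))
    -- Compatibility of the pieces: by naturality of `ofSpec`, the two congruences attached to `y`
    -- correspond under a transition map, so they become equal in the colimit.
    fun _ V f y => (congrArg (ιSCong V) (ofSpec_baseExtDiagram_map X R f y)).trans (ιSCong_map f _)

lemma isGamma_gamma : X.IsGamma R (X.gamma R) := fun U y => glueBaseExt_ι X R _ _ U y

variable {X R}

/-- The open subschemes `U_R` cover `X_R`, and the defining property prescribes the values on each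
of them. -/
lemma IsGamma.eq {γ γ' : C(X.baseExt R, X.SCong)} (h : X.IsGamma R γ) (h' : X.IsGamma R γ') :
    γ = γ' := by
  ext x
  obtain ⟨U, y, rfl⟩ := exists_ιBaseExt_eq X R x
  rw [h, h']

lemma IsGamma.πSCong_comp {γ : C(X.baseExt R, X.SCong)} (h : X.IsGamma R γ) :
    X.πSCong.comp γ = X.proj R := by
  ext x
  obtain ⟨U, y, rfl⟩ := exists_ιBaseExt_eq X R x
  rw [proj_ι, ContinuousMap.comp_apply, h, πSCong_ι]
  exact congrArg (ιMSpec U) (PMon.SCong.nullIdeal_ofSpec (BaseRing.of R U.sections) y)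

/-- The images of the spaces `SCong Γ(U)` cover `SCong X`, which reduces the claim to the affine
statement `ofSpec_surjective`. -/
lemma IsGamma.surjective {γ : C(X.baseExt ℤ, X.SCong)} (h : X.IsGamma ℤ γ) :
    Function.Surjective γ := by
  intro x
  obtain ⟨U, c, rfl⟩ := exists_ιSCong_eq x
  obtain ⟨y, rfl⟩ := PMon.SCong.ofSpec_surjective U.sections c
  exact ⟨ιBaseExt ℤ U y, h U y⟩

end MonoidScheme

/-- The inclusion `γ(U_R) ⊆ SCong U` is part of `IsGamma`, which writes the values on `U_R` as
images under `ιSCong U`. The last clause speaks of any map with the characterizing property over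
`ℤ`; by the second clause for `ℤ` there is exactly one. -/
theorem mainTheorem3 (X : MonoidScheme.{u}) (R : Type v) [CommRing R] :
    (∀ U : X.AffineOpens, Topology.IsOpenEmbedding (MonoidScheme.ιSCong U)) ∧
    (∃ γ : C(X.baseExt R, X.SCong), X.IsGamma R γ ∧
      (∀ γ' : C(X.baseExt R, X.SCong), X.IsGamma R γ' → γ' = γ) ∧
      X.πSCong.comp γ = X.proj R) ∧
    (∀ γ : C(X.baseExt ℤ, X.SCong), X.IsGamma ℤ γ → Function.Surjective γ) :=
  ⟨MonoidScheme.isOpenEmbedding_ιSCong,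
    ⟨X.gamma R, X.isGamma_gamma R, fun _ h => h.eq (X.isGamma_gamma R),
      (X.isGamma_gamma R).πSCong_comp⟩,
    fun _ h => h.surjective⟩
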